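/- There are absolute constants $C, C_1 > 0$ such that the following holds. Let $n \ge 0$, $m, p \ge 1$ be integers, let $\Sigma_* \in \mathbb{R}^{m\times m}$ be symmetric positive definite, let $\theta^* \in \mathbb{R}^p$, and let $$y_i = X_i \theta^* + \eta_i, \qquad i = 1, \dots, n,$$ where $X_i$ is a random $m \times p$ matrix, $\eta_i \sim N(0, \Sigma_*)$, $X_i$ and $\eta_i$ are independent of each other, and the pairs $(X_1,\eta_1), \dots, (X_n,\eta_n)$ are independent. For a real random variable $x$ put $\|x\|_{\psi_2} = \sup_{q \ge 1} q^{-1/2} (\mathbb{E}|x|^q)^{1/q}$, and for a random vector $x$ put $\|x\|_{\psi_2} = \sup_{\|u\|_2 = 1} \|\langle x, u\rangle\|_{\psi_2}$. Let $\kappa_0$ be the $\psi_2$-norm of a standard Gaussian random vector in $\mathbb{R}^m$. Assume that every $X_i$ is sub-Gaussian with parameters $\kappa, \mu_{\min}, \mu_{\max}$, that is, for $X = X_i$ and $\Gamma_u = \mathbb{E}[X^T u u^T X]$, $$0 < \mu_{\min} \le \lambda_{\min}(\Gamma_u) \le \lambda_{\max}(\Gamma_u) \le \mu_{\max} < \infty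 \quad \text{for all } u \in \mathbb{R}^m,\ \|u\|_2 = 1,$$ $$\sup_{\|v\|_2 = 1,\ \|u\|_2 = 1} \big\| v^T \Gamma_u^{-1/2} X^T u \big\|_{\psi_2} \le \kappa < \infty .$$ Let $\theta \in \mathbb{R}^p$ be an arbitrary fixed (non-random) vector and let $\hat\Sigma = \frac1n \sum_{i=1}^n (y_i - X_i\theta)(y_i - X_i\theta)^T$. If $$n \ \ge\ C^4 m \cdot \max\left\{ 4\left(\kappa_0 + \kappa \sqrt{\tfrac{\mu_{\max}}{\lambda_{\min}(\Sigma_*)}}\, \|\theta^* - \theta\|_2\right)^4,\ \ \kappa^4 \left(\frac{\lambda_{\max}(\Sigma_*)\,\mu_{\max}}{\lambda_{\min}(\Sigma_*)\,\mu_{\min}}\right)^2 \right\},$$ then, with probability at least $1 - 2\exp(-C_1 m)$, both $$\lambda_{\max}\left(\Sigma_*^{-1/2} \hat\Sigma\, \Sigma_*^{-1/2}\right) \le 1 + C^2 \kappa_0^2 \sqrt{\frac mn} + \frac{2\mu_{\max}}{\lambda_{\min}(\Sigma_*)} \|\theta^* - \theta\|_2^2$$ and $$\lambda_{\min}\left(\Sigma_*^{-1/2}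 \hat\Sigma\, \Sigma_*^{-1/2}\right) \ge 1 - C^2 \kappa_0^2 \sqrt{\frac mn}.$$ -/

import Mathlib

open MeasureTheory ProbabilityTheory Matrix
open scoped NNReal ENNReal MatrixOrder

/-- Random matrices are measurable when their entries are. -/
instance matrixMeasurableSpace {m n α : Type*} [MeasurableSpace α] :
    MeasurableSpace (Matrix m n α) :=
  inferInstanceAs (MeasurableSpace (m → n → α))

noncomputable section

/-- The `ψ₂`-norm `sup_{q ≥ 1} (E |x|^q)^{1/q} / √q` of a real random variable `x`. -/
def psi2Norm {Ω : Type*} [MeasurableSpace Ω] (x : Ω → ℝ) (P : Measure Ω) : ℝ≥0∞ :=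
  ⨆ (q : ℝ) (_ : 1 ≤ q), eLpNorm x (ENNReal.ofReal q) P / ENNReal.ofReal (√q)

/-- The `ψ₂`-norm of a random vector: the supremum of the `ψ₂`-norms of its one-dimensional
marginals `⟨x, u⟩`, over unit vectors `u`. -/
def psi2NormVec {Ω : Type*} [MeasurableSpace Ω] {d : ℕ} (x : Ω → EuclideanSpace ℝ (Fin d))
    (P : Measure Ω) : ℝ≥0∞ :=
  ⨆ u ∈ Metric.sphere (0 : EuclideanSpace ℝ (Fin d)) 1, psi2Norm (fun ω => inner ℝ (x ω) u) P

/-- `κ₀`: the `ψ₂`-norm of a standard Gaussian random vector in `ℝ^d` (the same finite number for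
all `d ≥ 1`). -/
def kappa0 (d : ℕ) : ℝ :=
  (psi2NormVec (fun x => x) (stdGaussian (EuclideanSpace ℝ (Fin d)))).toReal

/-- The largest eigenvalue of a symmetric real matrix. -/
def lambdaMax {d : ℕ} (A : Matrix (Fin d) (Fin d) ℝ) : ℝ := sSup (spectrum ℝ A)

/-- The smallest eigenvalue of a symmetric real matrix. -/
def lambdaMin {d : ℕ} (A : Matrix (Fin d) (Fin d) ℝ) : ℝ := sInf (spectrum ℝ A)

/-- `A^{-1/2}` for a positive definite matrix `A`. -/
def invSqrt {d : ℕ} (A : Matrix (Fin d) (Fin d) ℝ) : Matrix (Fin d) (Fin d) ℝ := (CFC.sqrt A)⁻¹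

/-- `Γ_u = E[Xᵀ u uᵀ X]`, entry by entry. -/
def gammaMat {Ω : Type*} [MeasurableSpace Ω] {m p : ℕ} (X : Ω → Matrix (Fin m) (Fin p) ℝ)
    (P : Measure Ω) (u : EuclideanSpace ℝ (Fin m)) : Matrix (Fin p) (Fin p) ℝ :=
  Matrix.of fun a b => ∫ ω, ((X ω)ᵀ *ᵥ u.ofLp) a * ((X ω)ᵀ *ᵥ u.ofLp) b ∂P

/-- The `ψ₂`-norm of a random matrix:
`sup_{‖v‖ = 1, ‖u‖ = 1} ‖vᵀ Γ_u^{-1/2} Xᵀ u‖_{ψ₂}`. -/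
def psi2NormMat {Ω : Type*} [MeasurableSpace Ω] {m p : ℕ} (X : Ω → Matrix (Fin m) (Fin p) ℝ)
    (P : Measure Ω) : ℝ≥0∞ :=
  ⨆ v ∈ Metric.sphere (0 : EuclideanSpace ℝ (Fin p)) 1,
    ⨆ u ∈ Metric.sphere (0 : EuclideanSpace ℝ (Fin m)) 1,
      psi2Norm (fun ω => v.ofLp ⬝ᵥ (invSqrt (gammaMat X P u) *ᵥ ((X ω)ᵀ *ᵥ u.ofLp))) P

/-- `X` is a sub-Gaussian random matrix with parameters `κ`, `μ_min`, `μ_max`: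
`‖X‖_{ψ₂} ≤ κ < ∞` and `0 < μ_min ≤ λ_min(Γ_u) ≤ λ_max(Γ_u) ≤ μ_max` for all unit vectors `u`. -/
structure IsSubGaussianMatrix {Ω : Type*} [MeasurableSpace Ω] {m p : ℕ}
    (X : Ω → Matrix (Fin m) (Fin p) ℝ) (P : Measure Ω) (κ : ℝ≥0) (muMin muMax : ℝ) : Prop where
  measurable : Measurable X
  muMin_pos : 0 < muMin
  muMin_le : ∀ u ∈ Metric.sphere (0 : EuclideanSpace ℝ (Fin m)) 1,
    muMin ≤ lambdaMin (gammaMat X P u)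
  le_muMax : ∀ u ∈ Metric.sphere (0 : EuclideanSpace ℝ (Fin m)) 1,
    lambdaMax (gammaMat X P u) ≤ muMax
  psi2Norm_le : psi2NormMat X P ≤ κ

/-- The sample covariance `n⁻¹ ∑ᵢ (yᵢ - Xᵢ θ)(yᵢ - Xᵢ θ)ᵀ` of the residuals at `θ`. -/
def residualCov {n m p : ℕ} (X : Fin n → Matrix (Fin m) (Fin p) ℝ)
    (y : Fin n → EuclideanSpace ℝ (Fin m)) (θ : EuclideanSpace ℝ (Fin p)) :
    Matrix (Fin m) (Fin m) ℝ :=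
  (1 / (n : ℝ)) • ∑ i, vecMulVec ((y i).ofLp - X i *ᵥ θ.ofLp) ((y i).ofLp - X i *ᵥ θ.ofLp)

end

/-!
Let `D = θ* - θ`. The whitened residuals `wᵢ = Σ_*^{-1/2} (Xᵢ D + ηᵢ)` are independent, and
`Σ_*^{-1/2} Σ̂ Σ_*^{-1/2}` is their empirical second moment matrix, so its eigenvalues are governed
by `n⁻¹ ∑ᵢ ⟨wᵢ, u⟩²` for unit vectors `u`.

In a direction `u`, `⟨wᵢ, u⟩` is the sum of a standard Gaussian and of an independent variable
linear in `Xᵢ`. Hence (`whitenedResidual_bounds`) its `ψ₂`-norm is at most `K = κ₀ + κ √b`, and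
its second moment lies in `[1 + a, 1 + b]`, where `a = (μ_min / λ_max) ‖D‖²` and
`b = (μ_max / λ_min) ‖D‖²`.

A square of a sub-Gaussian variable has a Bernstein-type moment generating function
(`integrable_exp_and_mgf_centered_sq_le`), so Chernoff's bound, a union bound over a `1 / 4`-net of
the sphere (`exists_net_sphere`) and the comparison of a quadratic form with its values on the net
(`abs_quadraticForm_le_of_net`) show that, outside an event of probability at most `2 exp (-m)`,
all the empirical second moments are within `576 K² √(m / n)` of their expectations
(`one_sub_le_measureReal_forall_abs_sum_centered_sq_le`).

Finally `K² ≤ 2 κ₀² + 2 κ² b`. The sample size condition involving `b / a` is exactly what makes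
the part of the deviation coming from `κ² b` at most `a` (`deviation_le`). In the lower bound it is
then absorbed by the excess `a` of the second moment over `1`, and in the upper bound `a ≤ b` gives
the factor `2`. The constants are `C = 34` and `C₁ = 1`.
-/

/-! ### Extreme eigenvalues and quadratic forms -/

theorem Matrix.IsHermitian.spectrum_real_nonempty {d : ℕ} (hd : 0 < d)
    {A : Matrix (Fin d) (Fin d) ℝ} (hA : A.IsHermitian) : (spectrum ℝ A).Nonempty :=
  ⟨_, hA.eigenvalues_mem_spectrum_real ⟨0, hd⟩⟩

theorem dotProduct_mulVec_le_lambdaMax {d : ℕ} {A : Matrix (Fin d) (Fin d) ℝ}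
    (hA : A.IsHermitian) (v : Fin d → ℝ) : v ⬝ᵥ A *ᵥ v ≤ lambdaMax A * (v ⬝ᵥ v) := by
  have h : A ≤ algebraMap ℝ _ (lambdaMax A) :=
    le_algebraMap_of_spectrum_le
      (fun x hx => le_csSup (Matrix.finite_real_spectrum (A := A)).bddAbove hx) hA
  have h2 := (Matrix.le_iff.1 h).dotProduct_mulVec_nonneg v
  simp only [star_trivial, Matrix.sub_mulVec, dotProduct_sub, Algebra.algebraMap_eq_smul_one,
    Matrix.smul_mulVec, Matrix.one_mulVec, dotProduct_smul, smul_eq_mul] at h2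
  linarith

theorem lambdaMin_mul_le_dotProduct_mulVec {d : ℕ} {A : Matrix (Fin d) (Fin d) ℝ}
    (hA : A.IsHermitian) (v : Fin d → ℝ) : lambdaMin A * (v ⬝ᵥ v) ≤ v ⬝ᵥ A *ᵥ v := by
  have h : algebraMap ℝ _ (lambdaMin A) ≤ A :=
    algebraMap_le_of_le_spectrum
      (fun x hx => csInf_le (Matrix.finite_real_spectrum (A := A)).bddBelow hx) hA
  have h2 := (Matrix.le_iff.1 h).dotProduct_mulVec_nonneg v
  simp only [star_trivial, Matrix.sub_mulVec, dotProduct_sub, Algebra.algebraMap_eq_smul_one,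
    Matrix.smul_mulVec, Matrix.one_mulVec, dotProduct_smul, smul_eq_mul] at h2
  linarith

theorem lambdaMin_le_lambdaMax {d : ℕ} (hd : 0 < d) {A : Matrix (Fin d) (Fin d) ℝ}
    (hA : A.IsHermitian) : lambdaMin A ≤ lambdaMax A :=
  csInf_le_csSup (hA.spectrum_real_nonempty hd) Matrix.finite_real_spectrum.bddBelow
    Matrix.finite_real_spectrum.bddAbove

/-- Every point of the spectrum is the value of the quadratic form at a unit eigenvector. -/
theorem exists_unit_dotProduct_mulVec_eq {d : ℕ} {A : Matrix (Fin d) (Fin d) ℝ} {x : ℝ}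
    (hx : x ∈ spectrum ℝ A) : ∃ v : EuclideanSpace ℝ (Fin d), ‖v‖ = 1 ∧
      v.ofLp ⬝ᵥ A *ᵥ v.ofLp = x := by
  rw [← Matrix.spectrum_toLin', ← Module.End.hasEigenvalue_iff_mem_spectrum] at hx
  obtain ⟨v, hv⟩ := hx.exists_hasEigenvector
  have hAv : A *ᵥ v = x • v := by simpa using hv.apply_eq_smul
  have h0 : WithLp.toLp 2 v ≠ 0 := by simpa using hv.2
  have hsq : v ⬝ᵥ v = ‖WithLp.toLp 2 v‖ ^ 2 := by
    rw [EuclideanSpace.real_norm_sq_eq]; simp [dotProduct, sq]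
  refine ⟨‖WithLp.toLp 2 v‖⁻¹ • WithLp.toLp 2 v, norm_smul_inv_norm h0, ?_⟩
  simp only [WithLp.ofLp_smul, mulVec_smul, hAv, dotProduct_smul, smul_dotProduct, hsq,
    smul_eq_mul]
  have := norm_ne_zero_iff.2 h0
  field_simp

theorem lambdaMax_le {d : ℕ} (hd : 0 < d) {A : Matrix (Fin d) (Fin d) ℝ} (hA : A.IsHermitian)
    {c : ℝ} (h : ∀ v : EuclideanSpace ℝ (Fin d), ‖v‖ = 1 → v.ofLp ⬝ᵥ A *ᵥ v.ofLp ≤ c) :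
    lambdaMax A ≤ c := by
  refine csSup_le (hA.spectrum_real_nonempty hd) fun x hx => ?_
  obtain ⟨v, hv, rfl⟩ := exists_unit_dotProduct_mulVec_eq hx
  exact h v hv

theorem le_lambdaMin {d : ℕ} (hd : 0 < d) {A : Matrix (Fin d) (Fin d) ℝ} (hA : A.IsHermitian)
    {c : ℝ} (h : ∀ v : EuclideanSpace ℝ (Fin d), ‖v‖ = 1 → c ≤ v.ofLp ⬝ᵥ A *ᵥ v.ofLp) :
    c ≤ lambdaMin A := by
  refine le_csInf (hA.spectrum_real_nonempty hd) fun x hx => ?_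
  obtain ⟨v, hv, rfl⟩ := exists_unit_dotProduct_mulVec_eq hx
  exact h v hv

theorem Matrix.PosDef.lambdaMin_pos {d : ℕ} (hd : 0 < d) {A : Matrix (Fin d) (Fin d) ℝ}
    (hA : A.PosDef) : 0 < lambdaMin A := by
  have hmem : lambdaMin A ∈ spectrum ℝ A :=
    (hA.1.spectrum_real_nonempty hd).csInf_mem Matrix.finite_real_spectrum
  obtain ⟨v, hv, h⟩ := exists_unit_dotProduct_mulVec_eq hmem
  rw [← h]
  have := hA.dotProduct_mulVec_pos (x := v.ofLp) (by
    intro h0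
    have : v = 0 := by ext i; simp [h0]
    simp [this] at hv)
  simpa using this

theorem posDef_of_lambdaMin_pos {d : ℕ} {A : Matrix (Fin d) (Fin d) ℝ} (hA : A.IsHermitian)
    (h : 0 < lambdaMin A) : A.PosDef := by
  refine .of_dotProduct_mulVec_pos hA fun x hx => ?_
  have h1 : 0 < x ⬝ᵥ x := by simpa using Matrix.dotProduct_star_self_pos_iff.2 hx
  simpa using (mul_pos h h1).trans_le (lambdaMin_mul_le_dotProduct_mulVec hA x)

theorem EuclideanSpace.dotProduct_self_eq {d : ℕ} (v : EuclideanSpace ℝ (Fin d)) :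
    v.ofLp ⬝ᵥ v.ofLp = ‖v‖ ^ 2 := by
  rw [EuclideanSpace.real_norm_sq_eq]; simp [dotProduct, sq]

/-! ### Inverse square roots -/

section invSqrt

variable {d : ℕ} {A : Matrix (Fin d) (Fin d) ℝ}

theorem cfcSqrt_isHermitian (A : Matrix (Fin d) (Fin d) ℝ) : (CFC.sqrt A).IsHermitian :=
  (CFC.sqrt_nonneg A).isSelfAdjoint

theorem Matrix.PosDef.sqrt_mul_sqrt (hA : A.PosDef) : CFC.sqrt A * CFC.sqrt A = A :=
  CFC.sqrt_mul_sqrt_self A hA.posSemidef.nonneg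

theorem Matrix.PosDef.isUnit_det_sqrt (hA : A.PosDef) : IsUnit (CFC.sqrt A).det := by
  have h : (CFC.sqrt A).det * (CFC.sqrt A).det = A.det := by
    rw [← det_mul, hA.sqrt_mul_sqrt]
  refine isUnit_iff_ne_zero.2 fun h0 => hA.det_pos.ne' ?_
  rw [← h, h0, zero_mul]

theorem invSqrt_isHermitian (A : Matrix (Fin d) (Fin d) ℝ) : (invSqrt A).IsHermitian :=
  (cfcSqrt_isHermitian A).inv

theorem Matrix.PosDef.sqrt_mul_invSqrt (hA : A.PosDef) : CFC.sqrt A * invSqrt A = 1 :=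
  Matrix.mul_nonsing_inv _ hA.isUnit_det_sqrt

theorem Matrix.IsHermitian.dotProduct_mulVec_comm (hA : A.IsHermitian) (u v : Fin d → ℝ) :
    u ⬝ᵥ A *ᵥ v = (A *ᵥ u) ⬝ᵥ v := by
  have : Aᵀ = A := by simpa using hA.eq
  rw [dotProduct_mulVec, ← mulVec_transpose, this]

theorem Matrix.PosDef.dotProduct_sqrt_mulVec_self (hA : A.PosDef) (v : Fin d → ℝ) :
    (CFC.sqrt A *ᵥ v) ⬝ᵥ (CFC.sqrt A *ᵥ v) = v ⬝ᵥ A *ᵥ v := by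
  rw [← (cfcSqrt_isHermitian A).dotProduct_mulVec_comm, mulVec_mulVec, hA.sqrt_mul_sqrt]

theorem Matrix.PosDef.invSqrt_mulVec_dotProduct_mulVec (hA : A.PosDef) (v : Fin d → ℝ) :
    (invSqrt A *ᵥ v) ⬝ᵥ A *ᵥ (invSqrt A *ᵥ v) = v ⬝ᵥ v := by
  rw [← hA.dotProduct_sqrt_mulVec_self, mulVec_mulVec, hA.sqrt_mul_invSqrt, one_mulVec]

end invSqrt

/-! ### Nets on the unit sphere -/

section Net

open Metric Module

variable {E : Type*} [NormedAddCommGroup E] [NormedSpace ℝ E] [FiniteDimensional ℝ E]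

/-- An `ε`-separated subset of the unit ball has at most `(1 + 2 / ε) ^ dim` points: the balls of
radius `ε / 2` about them are disjoint and lie in the ball of radius `1 + ε / 2`. -/
theorem card_le_of_separated_unitBall {ε : ℝ} (hε : 0 < ε) (s : Finset E)
    (hs : ∀ c ∈ s, ‖c‖ ≤ 1) (h : ∀ c ∈ s, ∀ d ∈ s, c ≠ d → ε ≤ ‖c - d‖) :
    (s.card : ℝ) ≤ (1 + 2 / ε) ^ finrank ℝ E := by
  borelize E
  let μ : Measure E := Measure.addHaar
  have hδ : 0 < ε / 2 := by positivity
  have hρ : 0 < 1 + ε / 2 := by positivity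
  have D : (s : Set E).PairwiseDisjoint fun c => ball c (ε / 2) := by
    intro c hc d hd hcd
    apply ball_disjoint_ball
    rw [dist_eq_norm]
    linarith [h c hc d hd hcd]
  have hsub : ⋃ c ∈ s, ball c (ε / 2) ⊆ ball (0 : E) (1 + ε / 2) := by
    refine Set.iUnion₂_subset fun x hx => ball_subset_ball' ?_
    rw [dist_zero_right]
    linarith [hs x hx]
  have I : (s.card : ℝ≥0∞) * ENNReal.ofReal ((ε / 2) ^ finrank ℝ E) * μ (ball 0 1) ≤
      ENNReal.ofReal ((1 + ε / 2) ^ finrank ℝ E) * μ (ball 0 1) :=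
    calc
      _ = μ (⋃ c ∈ s, ball c (ε / 2)) := by
        rw [measure_biUnion_finset D fun c _ => measurableSet_ball]
        simp only [μ.addHaar_ball_of_pos _ hδ, Finset.sum_const, nsmul_eq_mul, mul_assoc]
      _ ≤ μ (ball (0 : E) (1 + ε / 2)) := measure_mono hsub
      _ = _ := μ.addHaar_ball_of_pos _ hρ
  have J := (ENNReal.mul_le_mul_iff_left (measure_ball_pos _ _ zero_lt_one).ne'
    measure_ball_lt_top.ne).1 I
  have K := ENNReal.toReal_le_of_le_ofReal (pow_nonneg hρ.le _) J
  rw [ENNReal.toReal_mul, ENNReal.toReal_natCast, ENNReal.toReal_ofReal (by positivity),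
    ← le_div_iff₀ (by positivity), ← div_pow] at K
  refine K.trans_eq ?_
  congr 1
  field_simp
  ring

/-- A maximal `ε`-separated subset of the unit sphere is an `ε`-net of it. -/
theorem exists_net_sphere {ε : ℝ} (hε : 0 < ε) : ∃ N : Finset E,
    (N.card : ℝ) ≤ (1 + 2 / ε) ^ finrank ℝ E ∧ (∀ v ∈ N, ‖v‖ = 1) ∧
      ∀ u : E, ‖u‖ = 1 → ∃ v ∈ N, ‖u - v‖ ≤ ε := by
  classical
  let T : Set ℕ := {k | ∃ s : Finset E, s.card = k ∧ (∀ c ∈ s, ‖c‖ = 1) ∧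
    ∀ c ∈ s, ∀ d ∈ s, c ≠ d → ε ≤ ‖c - d‖}
  have hT : T.Nonempty := ⟨0, ∅, by simp⟩
  have hbdd : BddAbove T := by
    refine ⟨⌊(1 + 2 / ε) ^ finrank ℝ E⌋₊, ?_⟩
    rintro _ ⟨s, rfl, h1, h2⟩
    exact Nat.le_floor (card_le_of_separated_unitBall hε s (fun c hc => (h1 c hc).le) h2)
  obtain ⟨s, hs, h1, h2⟩ := Nat.sSup_mem hT hbdd
  refine ⟨s, card_le_of_separated_unitBall hε s (fun c hc => (h1 c hc).le) h2, h1,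
    fun u hu => ?_⟩
  by_contra! hcon
  have hus : u ∉ s := fun h => by
    have := hcon u h
    simp at this
    linarith
  have hmem : (insert u s).card ∈ T := by
    refine ⟨_, rfl, ?_, ?_⟩
    · simpa [hu] using h1
    · intro c hc d hd hcd
      rcases Finset.mem_insert.1 hc with rfl | hc <;> rcases Finset.mem_insert.1 hd with rfl | hd
      · exact absurd rfl hcd
      · exact (hcon d hd).le
      · rw [norm_sub_rev]; exact (hcon c (by assumption)).le
      · exact h2 c hc d hd hcd
  have := le_csSup hbdd hmem
  rw [Finset.card_insert_of_notMem hus, hs] at this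
  omega

/-- A quadratic form bounded by `t` on a `1 / 4`-net of the unit sphere is bounded by `2 t` on the
whole sphere. -/
theorem abs_quadraticForm_le_of_net {E : Type*} [NormedAddCommGroup E] [InnerProductSpace ℝ E]
    [FiniteDimensional ℝ E] (B : E →ₗ[ℝ] E →ₗ[ℝ] ℝ) (hB : ∀ x y, B x y = B y x)
    {N : Finset E} (hN : ∀ v ∈ N, ‖v‖ = 1)
    (hnet : ∀ u : E, ‖u‖ = 1 → ∃ v ∈ N, ‖u - v‖ ≤ 1 / 4)
    {t : ℝ} (ht : ∀ v ∈ N, |B v v| ≤ t) {u : E} (hu : ‖u‖ = 1) : |B u u| ≤ 2 * t := by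
  have hcont : Continuous fun v : E => |B v v| := by
    have h1 : Continuous fun v : E => (LinearMap.toContinuousLinearMap.toLinearMap ∘ₗ B) v v :=
      ((LinearMap.toContinuousLinearMap.toLinearMap ∘ₗ B).continuous_of_finiteDimensional).clm_apply
        continuous_id
    exact h1.abs
  obtain ⟨u₀, hu₀, hmax⟩ := (isCompact_sphere (0 : E) 1).exists_isMaxOn
    ⟨u, by simpa using hu⟩ hcont.continuousOn
  have hu₀' : ‖u₀‖ = 1 := by simpa using hu₀
  set M := |B u₀ u₀| with hM
  have hM0 : 0 ≤ M := abs_nonneg _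
  have hbound : ∀ x : E, |B x x| ≤ M * ‖x‖ ^ 2 := by
    intro x
    rcases eq_or_ne x 0 with rfl | hx
    · simp
    have hx' := norm_ne_zero_iff.2 hx
    have h1 : |B (‖x‖⁻¹ • x) (‖x‖⁻¹ • x)| ≤ M :=
      hmax (by simpa using norm_smul_inv_norm (𝕜 := ℝ) hx)
    simp only [map_smul, LinearMap.smul_apply, smul_eq_mul, abs_mul, abs_inv, abs_norm] at h1
    rw [← mul_assoc, ← mul_inv, inv_mul_le_iff₀ (by positivity)] at h1
    linarith
  obtain ⟨v, hv, huv⟩ := hnet u₀ hu₀'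
  have hv1 := hN v hv
  -- Polarisation of `B (u₀ + v) (8 • (u₀ - v))`; the factor `8` balances the lengths of the two
  -- arguments, which are at most `2` and `8 * (1 / 4)`.
  set x := u₀ + v
  set y := (8 : ℝ) • (u₀ - v) with hy
  have hpol : 8 * (B u₀ u₀ - B v v) = (B (x + y) (x + y) - B (x - y) (x - y)) / 4 := by
    simp only [x, y, map_add, map_sub, map_smul, LinearMap.add_apply, LinearMap.sub_apply,
      LinearMap.smul_apply, smul_eq_mul, hB v u₀]
    ring
  have hxn : ‖x‖ ≤ 2 := (norm_add_le _ _).trans (by rw [hu₀', hv1]; norm_num)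
  have hyn : ‖y‖ ≤ 2 := by
    rw [hy, norm_smul, Real.norm_of_nonneg (by norm_num)]
    linarith
  have hpar := parallelogram_law_with_norm ℝ x y
  have h8 : |8 * (B u₀ u₀ - B v v)| ≤ 4 * M := by
    rw [hpol, abs_div, abs_of_pos (four_pos : (0 : ℝ) < 4), div_le_iff₀ four_pos]
    have h16 : ‖x + y‖ ^ 2 + ‖x - y‖ ^ 2 ≤ 16 := by
      nlinarith [norm_nonneg x, norm_nonneg y]
    calc |B (x + y) (x + y) - B (x - y) (x - y)|
        ≤ |B (x + y) (x + y)| + |B (x - y) (x - y)| := abs_sub _ _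
      _ ≤ M * ‖x + y‖ ^ 2 + M * ‖x - y‖ ^ 2 := add_le_add (hbound _) (hbound _)
      _ = M * (‖x + y‖ ^ 2 + ‖x - y‖ ^ 2) := by ring
      _ ≤ M * 16 := by gcongr
      _ = 4 * M * 4 := by ring
  rw [abs_mul, abs_of_pos (by norm_num : (0 : ℝ) < 8)] at h8
  have h1 : M ≤ |B u₀ u₀ - B v v| + |B v v| := by
    simpa [hM] using abs_add_le (B u₀ u₀ - B v v) (B v v)
  have h2 : |B u u| ≤ M := hmax (by simpa using hu)
  linarith [ht v hv]

end Net

/-! ### Exponential moments of squares of sub-Gaussian variables -/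

section SubGaussian

open Real

variable {Ω : Type*} [MeasurableSpace Ω] {P : Measure Ω} {s : Ω → ℝ} {K : ℝ}

theorem psi2Norm_le_iff {c : ℝ≥0∞} : psi2Norm s P ≤ c ↔
    ∀ q : ℝ, 1 ≤ q → eLpNorm s (ENNReal.ofReal q) P ≤ c * ENNReal.ofReal (√q) := by
  simp only [psi2Norm, iSup_le_iff]
  refine forall₂_congr fun q hq => ENNReal.div_le_iff ?_ ENNReal.ofReal_ne_top
  have : 0 < √q := sqrt_pos.2 (by linarith)
  simpa using this

theorem memLp_two_of_psi2Norm_le (hs : AEMeasurable s P) (hK : psi2Norm s P ≤ ENNReal.ofReal K) :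
    MemLp s 2 P := by
  refine ⟨hs.aestronglyMeasurable, ?_⟩
  have := psi2Norm_le_iff.1 hK 2 (by norm_num)
  rw [ENNReal.ofReal_ofNat] at this
  exact this.trans_lt (ENNReal.mul_lt_top ENNReal.ofReal_lt_top ENNReal.ofReal_lt_top)

theorem lintegral_pow_le_of_psi2Norm_le (hK0 : 0 ≤ K) (hK : psi2Norm s P ≤ ENNReal.ofReal K)
    {k : ℕ} (hk : k ≠ 0) :
    ∫⁻ ω, ENNReal.ofReal (s ω ^ (2 * k)) ∂P ≤ ENNReal.ofReal ((2 * k * K ^ 2) ^ k) := by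
  have hk1 : (1 : ℝ) ≤ k := by exact_mod_cast Nat.one_le_iff_ne_zero.2 hk
  have hq : (0 : ℝ) < 2 * k := by linarith
  have h := psi2Norm_le_iff.1 hK (2 * k) (by linarith)
  rw [eLpNorm_eq_lintegral_rpow_enorm_toReal (ENNReal.ofReal_pos.2 hq).ne' ENNReal.ofReal_ne_top,
    ENNReal.toReal_ofReal hq.le, one_div, ENNReal.rpow_inv_le_iff hq,
    ← ENNReal.ofReal_mul hK0] at h
  have hcast : (2 * k : ℝ) = ((2 * k : ℕ) : ℝ) := by push_cast; rfl
  have h1 : ∀ ω, ENNReal.ofReal (s ω ^ (2 * k)) = ‖s ω‖ₑ ^ (2 * k : ℝ) := fun ω => by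
    rw [hcast, ENNReal.rpow_natCast, enorm_eq_ofReal_abs, ← ENNReal.ofReal_pow (abs_nonneg _),
      pow_mul, pow_mul, sq_abs]
  simp_rw [h1]
  refine h.trans_eq ?_
  rw [hcast, ENNReal.rpow_natCast, ← ENNReal.ofReal_pow (by positivity), ← hcast, pow_mul, mul_pow,
    sq_sqrt hq.le, mul_comm]

/-- Expand the exponential: the `k`-th moment term is at most `(2 e γ K²) ^ k ≤ 2⁻ᵏ`, because
`k ^ k / k! ≤ e ^ k` and `e ≤ 3`. -/
theorem lintegral_exp_mul_sq_le [IsProbabilityMeasure P] (hs : AEMeasurable s P) (hK0 : 0 ≤ K)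
    (hK : psi2Norm s P ≤ ENNReal.ofReal K) {γ : ℝ} (hγ : 0 ≤ γ) (hγK : 12 * γ * K ^ 2 ≤ 1) :
    ∫⁻ ω, ENNReal.ofReal (exp (γ * s ω ^ 2)) ∂P ≤ 2 := by
  have hterm : ∀ k : ℕ, ∫⁻ ω, ENNReal.ofReal ((γ * s ω ^ 2) ^ k / k.factorial) ∂P ≤
      (2⁻¹ : ℝ≥0∞) ^ k := by
    intro k
    rcases eq_or_ne k 0 with rfl | hk
    · simp
    have h1 : ∀ ω, ENNReal.ofReal ((γ * s ω ^ 2) ^ k / k.factorial) =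
        ENNReal.ofReal (γ ^ k / k.factorial) * ENNReal.ofReal (s ω ^ (2 * k)) := fun ω => by
      rw [← ENNReal.ofReal_mul (by positivity)]
      congr 1
      rw [mul_pow, pow_mul]
      ring
    simp_rw [h1]
    rw [lintegral_const_mul' _ _ ENNReal.ofReal_ne_top]
    refine (mul_le_mul_right (lintegral_pow_le_of_psi2Norm_le hK0 hK hk) _).trans ?_
    rw [← ENNReal.ofReal_mul (by positivity)]
    have h2 : γ ^ k / k.factorial * (2 * k * K ^ 2) ^ k ≤ (2⁻¹ : ℝ) ^ k := by
      have h3 : (k : ℝ) ^ k / k.factorial ≤ exp 1 ^ k := by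
        rw [← exp_nat_mul, mul_one]
        exact pow_div_factorial_le_exp _ (by positivity) k
      calc γ ^ k / k.factorial * (2 * k * K ^ 2) ^ k
          = (2 * γ * K ^ 2) ^ k * ((k : ℝ) ^ k / k.factorial) := by
            simp only [mul_pow]; ring
        _ ≤ (2 * γ * K ^ 2) ^ k * exp 1 ^ k := by gcongr
        _ = (2 * γ * K ^ 2 * exp 1) ^ k := (mul_pow _ _ _).symm
        _ ≤ (2⁻¹ : ℝ) ^ k := by
          have : exp 1 ≤ 3 := exp_one_lt_three.le
          have h4 : 0 ≤ 2 * γ * K ^ 2 := by positivity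
          gcongr
          nlinarith
    refine (ENNReal.ofReal_le_ofReal h2).trans_eq ?_
    rw [ENNReal.ofReal_pow (by norm_num), ENNReal.ofReal_inv_of_pos two_pos, ENNReal.ofReal_ofNat]
  calc ∫⁻ ω, ENNReal.ofReal (exp (γ * s ω ^ 2)) ∂P
      = ∫⁻ ω, ∑' k : ℕ, ENNReal.ofReal ((γ * s ω ^ 2) ^ k / k.factorial) ∂P := by
        refine lintegral_congr fun ω => ?_
        have h := NormedSpace.expSeries_div_hasSum_exp (γ * s ω ^ 2)
        rw [← exp_eq_exp_ℝ] at h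
        rw [← h.tsum_eq, ENNReal.ofReal_tsum_of_nonneg (fun k => by positivity) h.summable]
    _ = ∑' k : ℕ, ∫⁻ ω, ENNReal.ofReal ((γ * s ω ^ 2) ^ k / k.factorial) ∂P :=
        lintegral_tsum fun k => by fun_prop
    _ ≤ ∑' k : ℕ, (2⁻¹ : ℝ≥0∞) ^ k := ENNReal.tsum_le_tsum hterm
    _ = 2 := by rw [ENNReal.tsum_geometric, ENNReal.one_sub_inv_two, inv_inv]

theorem exp_le_one_add_add_sq_mul_exp_abs (x : ℝ) : exp x ≤ 1 + x + x ^ 2 * exp |x| := by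
  have h := Complex.norm_exp_sub_sum_le_norm_mul_exp (x : ℂ) 2
  simp only [Finset.sum_range_succ, Finset.sum_range_zero, pow_zero, pow_one, Nat.factorial,
    Nat.cast_one, div_one, zero_add, Complex.norm_real, norm_eq_abs, sq_abs, mul_one] at h
  have h2 : ‖Complex.exp x - (1 + x)‖ = |exp x - (1 + x)| := by
    rw [← norm_eq_abs, ← Complex.norm_real]
    push_cast
    rfl
  rw [h2] at h
  linarith [le_abs_self (exp x - (1 + x))]

/-- The Bernstein-type bound on the moment generating function of a centred square `Z`: with
`β = 1 / (24 K²)`, the second order remainder of `exp (l Z)` is at most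
`2 (l / β)² exp (2 β |Z|)`, whose expectation is controlled by `lintegral_exp_mul_sq_le`. -/
theorem integrable_exp_and_mgf_centered_sq_le [IsProbabilityMeasure P] (hs : AEMeasurable s P)
    (hK0 : 0 < K) (hK : psi2Norm s P ≤ ENNReal.ofReal K) {l : ℝ} (hl : |l| ≤ 1 / (24 * K ^ 2)) :
    Integrable (fun ω => exp (l * (s ω ^ 2 - ∫ ω', s ω' ^ 2 ∂P))) P ∧
      mgf (fun ω => s ω ^ 2 - ∫ ω', s ω' ^ 2 ∂P) P l ≤ exp (8 * (24 * K ^ 2 * l) ^ 2) := by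
  set e := ∫ ω', s ω' ^ 2 ∂P with he
  set β := 1 / (24 * K ^ 2) with hβ
  have hβ0 : 0 < β := by positivity
  have hL2 := memLp_two_of_psi2Norm_le hs hK
  have hint2 : Integrable (fun ω => s ω ^ 2) P := hL2.integrable_sq
  have he0 : 0 ≤ e := integral_nonneg fun ω => sq_nonneg _
  have hmom : e ≤ 2 * K ^ 2 := by
    have h := lintegral_pow_le_of_psi2Norm_le hK0.le hK one_ne_zero
    rw [he, integral_eq_lintegral_of_nonneg_ae (ae_of_all _ fun ω => sq_nonneg _)
      hint2.aestronglyMeasurable]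
    refine ENNReal.toReal_le_of_le_ofReal (by positivity) ?_
    simpa using h
  have hlexp := lintegral_exp_mul_sq_le hs hK0.le hK (γ := 2 * β) (by positivity)
    (le_of_eq (by rw [hβ]; field_simp; norm_num))
  have hmeas : AEStronglyMeasurable (fun ω => exp (2 * β * s ω ^ 2)) P := by
    have : AEMeasurable (fun ω => exp (2 * β * s ω ^ 2)) P := by fun_prop
    exact this.aestronglyMeasurable
  have hintexp : Integrable (fun ω => exp (2 * β * s ω ^ 2)) P := by
    refine ⟨hmeas, ?_⟩
    rw [hasFiniteIntegral_iff_ofReal (ae_of_all _ fun ω => (exp_pos _).le)]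
    exact hlexp.trans_lt ENNReal.ofNat_lt_top
  have hexp2 : ∫ ω, exp (2 * β * s ω ^ 2) ∂P ≤ 2 := by
    rw [integral_eq_lintegral_of_nonneg_ae (ae_of_all _ fun ω => (exp_pos _).le) hmeas]
    exact ENNReal.toReal_le_of_le_ofReal (by norm_num) (by simpa using hlexp)
  have habs : ∀ ω, |s ω ^ 2 - e| ≤ s ω ^ 2 + e := fun ω => by
    rw [abs_le]; constructor <;> nlinarith [sq_nonneg (s ω)]
  -- `exp (2 β e)` is at most `2` because `2 β e ≤ 1 / 6`.
  have hexpe : exp (2 * β * e) ≤ 2 := by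
    have h1 : 2 * β * e ≤ 1 / 6 := by
      calc 2 * β * e ≤ 2 * β * (2 * K ^ 2) := by gcongr
        _ = 1 / 6 := by rw [hβ]; field_simp; norm_num
    have h2 := exp_bound_div_one_sub_of_interval (by positivity : 0 ≤ 2 * β * e) (by linarith)
    refine h2.trans ?_
    rw [div_le_iff₀ (by linarith)]
    linarith
  have hdom : ∀ ω, exp (2 * β * |s ω ^ 2 - e|) ≤ 2 * exp (2 * β * s ω ^ 2) := fun ω => by
    calc exp (2 * β * |s ω ^ 2 - e|) ≤ exp (2 * β * (s ω ^ 2 + e)) := by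
          gcongr; exact habs ω
      _ = exp (2 * β * e) * exp (2 * β * s ω ^ 2) := by rw [← exp_add]; ring_nf
      _ ≤ _ := by gcongr
  have hle : ∀ ω, |l * (s ω ^ 2 - e)| ≤ β * |s ω ^ 2 - e| := fun ω => by
    rw [abs_mul]; gcongr
  have hInt : Integrable (fun ω => exp (l * (s ω ^ 2 - e))) P := by
    refine (hintexp.const_mul 2).mono' ?_ (ae_of_all _ fun ω => ?_)
    · have : AEMeasurable (fun ω => exp (l * (s ω ^ 2 - e))) P := by fun_prop
      exact this.aestronglyMeasurable
    · rw [norm_of_nonneg (exp_pos _).le]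
      refine le_trans (exp_le_exp.2 ?_) (hdom ω)
      have := (le_abs_self _).trans (hle ω)
      have := mul_nonneg hβ0.le (abs_nonneg (s ω ^ 2 - e))
      linarith
  refine ⟨hInt, ?_⟩
  have hpt : ∀ ω, exp (l * (s ω ^ 2 - e)) ≤
      1 + l * (s ω ^ 2 - e) + 4 * (l / β) ^ 2 * exp (2 * β * s ω ^ 2) := fun ω => by
    set z := |s ω ^ 2 - e| with hz
    have hz0 : 0 ≤ β * z := by positivity
    have h1 := exp_le_one_add_add_sq_mul_exp_abs (l * (s ω ^ 2 - e))
    have h2 : (l * (s ω ^ 2 - e)) ^ 2 = (l / β) ^ 2 * (β * z) ^ 2 := by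
      rw [mul_pow, ← sq_abs (s ω ^ 2 - e), ← hz]; field_simp
    have h3 : (β * z) ^ 2 ≤ 2 * exp (β * z) := by
      linarith [quadratic_le_exp_of_nonneg hz0]
    have h4 : (l * (s ω ^ 2 - e)) ^ 2 * exp |l * (s ω ^ 2 - e)| ≤
        4 * (l / β) ^ 2 * exp (2 * β * s ω ^ 2) := by
      calc (l * (s ω ^ 2 - e)) ^ 2 * exp |l * (s ω ^ 2 - e)|
          ≤ (l / β) ^ 2 * (2 * exp (β * z)) * exp (β * z) := by
            rw [h2]; gcongr; exact hle ω
        _ = (l / β) ^ 2 * 2 * exp (2 * β * z) := by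
            rw [show 2 * β * z = β * z + β * z by ring, exp_add]; ring
        _ ≤ (l / β) ^ 2 * 2 * (2 * exp (2 * β * s ω ^ 2)) := by gcongr; exact hdom ω
        _ = _ := by ring
    linarith
  have hlin : Integrable (fun ω => l * (s ω ^ 2 - e)) P :=
    (hint2.sub (integrable_const _)).const_mul l
  have hzero : ∫ ω, l * (s ω ^ 2 - e) ∂P = 0 := by
    rw [integral_const_mul, integral_sub hint2 (integrable_const _)]
    simp [he]
  calc mgf (fun ω => s ω ^ 2 - e) P l
      ≤ ∫ ω, (1 + l * (s ω ^ 2 - e) + 4 * (l / β) ^ 2 * exp (2 * β * s ω ^ 2)) ∂P :=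
        integral_mono hInt (((integrable_const _).add hlin).add (hintexp.const_mul _)) hpt
    _ = 1 + 4 * (l / β) ^ 2 * ∫ ω, exp (2 * β * s ω ^ 2) ∂P := by
        rw [integral_add (f := fun ω => 1 + l * (s ω ^ 2 - e))
          ((integrable_const _).add hlin) (hintexp.const_mul _),
          integral_add (integrable_const _) hlin, hzero, integral_const_mul]
        simp
    _ ≤ 1 + 4 * (l / β) ^ 2 * 2 := by gcongr
    _ = 8 * (24 * K ^ 2 * l) ^ 2 + 1 := by rw [hβ]; field_simp; ring
    _ ≤ _ := add_one_le_exp _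

/-! ### Concentration of the empirical second moment -/

/-- Chernoff's method with `l = ± √(m / n) / (24 K²)`, which is in the admissible range because
`m ≤ n`: the exponent is `8 m` from the moment generating functions minus `12 m` from the
threshold. -/
theorem measureReal_abs_sum_centered_sq_ge_le [IsProbabilityMeasure P] {n m : ℕ} (hm : 0 < m)
    (hmn : m ≤ n) {s : Fin n → Ω → ℝ} (hs : ∀ i, AEMeasurable (s i) P) (hind : iIndepFun s P)
    (hK0 : 0 < K) (hK : ∀ i, psi2Norm (s i) P ≤ ENNReal.ofReal K) :
    P.real {ω | n * (288 * K ^ 2 * √((m : ℝ) / n)) ≤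
      |∑ i, (s i ω ^ 2 - ∫ ω', s i ω' ^ 2 ∂P)|} ≤ 2 * exp (-4 * m) := by
  set δ := √((m : ℝ) / n) with hδ
  have hn : (0 : ℝ) < n := by exact_mod_cast hm.trans_le hmn
  have hδ0 : 0 ≤ δ := sqrt_nonneg _
  have hδsq : δ ^ 2 = m / n := sq_sqrt (by positivity)
  have hδ1 : δ ≤ 1 := by
    rw [hδ, sqrt_le_one, div_le_one hn]
    exact_mod_cast hmn
  set Z : Fin n → Ω → ℝ := fun i ω => s i ω ^ 2 - ∫ ω', s i ω' ^ 2 ∂P with hZ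
  have hZind : iIndepFun Z P :=
    hind.comp (fun i x => x ^ 2 - ∫ ω', s i ω' ^ 2 ∂P) fun i => by fun_prop
  have hZm : ∀ i, AEMeasurable (Z i) P := fun i => by fun_prop
  set l := δ / (24 * K ^ 2) with hl
  have hl0 : 0 ≤ l := by positivity
  have key : ∀ l' : ℝ, |l'| = l → Integrable (fun ω => exp (l' * (∑ i, Z i) ω)) P ∧
      mgf (∑ i, Z i) P l' ≤ exp (8 * m) := by
    intro l' hl'
    have hle : |l'| ≤ 1 / (24 * K ^ 2) := by rw [hl', hl]; gcongr
    have hi := fun i => integrable_exp_and_mgf_centered_sq_le (hs i) hK0 (hK i) hle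
    rw [← mgf_pos_iff, hZind.mgf_sum₀ hZm]
    refine ⟨Finset.prod_pos fun i _ => mgf_pos_iff.2 (hi i).1, ?_⟩
    calc ∏ i, mgf (Z i) P l' ≤ ∏ i : Fin n, exp (8 * (24 * K ^ 2 * l') ^ 2) :=
          Finset.prod_le_prod (fun i _ => mgf_nonneg) fun i _ => (hi i).2
      _ = exp (8 * m) := by
          rw [Finset.prod_const, Finset.card_univ, Fintype.card_fin, ← exp_nat_mul]
          congr 1
          rw [mul_pow, ← sq_abs l', hl', hl]
          field_simp
          rw [hδsq]
          field_simp
  set t := n * (288 * K ^ 2 * δ) with ht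
  have hlt : l * t = 12 * m := by
    rw [hl, ht]
    field_simp
    rw [hδsq]
    field_simp
    norm_num
  have hup : P.real {ω | t ≤ (∑ i, Z i) ω} ≤ exp (-4 * m) := by
    obtain ⟨h1, h2⟩ := key l (abs_of_nonneg hl0)
    refine (measure_ge_le_exp_mul_mgf t hl0 h1).trans ?_
    calc exp (-l * t) * mgf (∑ i, Z i) P l ≤ exp (-l * t) * exp (8 * m) := by gcongr
      _ = exp (-4 * m) := by rw [← exp_add, neg_mul, hlt]; ring_nf
  have hlow : P.real {ω | (∑ i, Z i) ω ≤ -t} ≤ exp (-4 * m) := by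
    obtain ⟨h1, h2⟩ := key (-l) (by rw [abs_neg, abs_of_nonneg hl0])
    refine (measure_le_le_exp_mul_mgf (-t) (neg_nonpos.2 hl0) h1).trans ?_
    calc exp (- -l * -t) * mgf (∑ i, Z i) P (-l) ≤ exp (- -l * -t) * exp (8 * m) := by gcongr
      _ = exp (-4 * m) := by rw [← exp_add, neg_neg, mul_neg, hlt]; ring_nf
  have hsub : {ω | t ≤ |∑ i, Z i ω|} ⊆ {ω | t ≤ (∑ i, Z i) ω} ∪ {ω | (∑ i, Z i) ω ≤ -t} := by
    intro ω hω
    simp only [Set.mem_union, Set.mem_ofPred_eq, Finset.sum_apply] at hω ⊢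
    rcases le_abs.1 hω with h | h
    · exact Or.inl h
    · exact Or.inr (by linarith)
  calc P.real {ω | t ≤ |∑ i, Z i ω|} ≤ _ := measureReal_mono hsub
    _ ≤ _ := measureReal_union_le _ _
    _ ≤ exp (-4 * m) + exp (-4 * m) := add_le_add hup hlow
    _ = _ := by ring

end SubGaussian

section Uniform

open Real

variable {Ω : Type*} [MeasurableSpace Ω] {P : Measure Ω}

/-- The empirical second moments of `n` independent sub-Gaussian vectors of `ℝ^m`, taken in all
directions simultaneously, concentrate at rate `√(m / n)`. The union bound runs over a net of at
most `9 ^ m ≤ exp (3 m)` directions. -/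
theorem one_sub_le_measureReal_forall_abs_sum_centered_sq_le [IsProbabilityMeasure P] {n m : ℕ}
    (hm : 0 < m) (hmn : m ≤ n) {w : Fin n → Ω → EuclideanSpace ℝ (Fin m)}
    (hw : ∀ i, AEMeasurable (w i) P) (hind : iIndepFun w P) {K : ℝ} (hK0 : 0 < K)
    (hK : ∀ i u, ‖u‖ = 1 → psi2Norm (fun ω => inner ℝ (w i ω) u) P ≤ ENNReal.ofReal K) :
    1 - 2 * exp (-m) ≤ P.real {ω | ∀ u, ‖u‖ = 1 →
      |∑ i, (inner ℝ (w i ω) u ^ 2 - ∫ ω', inner ℝ (w i ω') u ^ 2 ∂P)| ≤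
        n * (576 * K ^ 2 * √((m : ℝ) / n))} := by
  set t := n * (288 * K ^ 2 * √((m : ℝ) / n)) with ht
  have hwm : ∀ i u, AEMeasurable (fun ω => inner ℝ (w i ω) u) P := fun i u => by
    have := hw i
    fun_prop
  have hL1 : ∀ i u, ‖u‖ = 1 → MemLp (fun ω => inner ℝ (w i ω) u) 2 P := fun i u hu =>
    memLp_two_of_psi2Norm_le (hwm i u) (hK i u hu)
  have hL : ∀ i u, MemLp (fun ω => inner ℝ (w i ω) u) 2 P := by
    intro i u
    rcases eq_or_ne u 0 with rfl | hu
    · simp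
    have h := (hL1 i _ (norm_smul_inv_norm (𝕜 := ℝ) hu)).const_mul ‖u‖
    refine h.ae_eq (ae_of_all _ fun ω => ?_)
    simp only [inner_smul_right, RCLike.ofReal_real_eq_id, id_eq]
    rw [mul_inv_cancel_left₀ (norm_ne_zero_iff.2 hu)]
  have hprod : ∀ i u v, Integrable (fun ω => inner ℝ (w i ω) u * inner ℝ (w i ω) v) P :=
    fun i u v => (hL i u).integrable_mul (hL i v)
  obtain ⟨N, hcard, hN1, hnet⟩ := exists_net_sphere (E := EuclideanSpace ℝ (Fin m))
    (ε := 1 / 4) (by norm_num)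
  -- The centred empirical second moment as a symmetric bilinear form.
  let B : Ω → EuclideanSpace ℝ (Fin m) →ₗ[ℝ] EuclideanSpace ℝ (Fin m) →ₗ[ℝ] ℝ := fun ω =>
    LinearMap.mk₂ ℝ (fun u v => ∑ i, (inner ℝ (w i ω) u * inner ℝ (w i ω) v -
        ∫ ω', inner ℝ (w i ω') u * inner ℝ (w i ω') v ∂P))
      (fun u u' v => by
        rw [← Finset.sum_add_distrib]
        refine Finset.sum_congr rfl fun i _ => ?_
        simp only [inner_add_right, add_mul]
        rw [integral_add (hprod i u v) (hprod i u' v)]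
        ring)
      (fun c u v => by
        rw [smul_eq_mul, Finset.mul_sum]
        refine Finset.sum_congr rfl fun i _ => ?_
        simp only [inner_smul_right, mul_assoc, integral_const_mul]
        ring)
      (fun u v v' => by
        rw [← Finset.sum_add_distrib]
        refine Finset.sum_congr rfl fun i _ => ?_
        simp only [inner_add_right, mul_add]
        rw [integral_add (hprod i u v) (hprod i u v')]
        ring)
      (fun c u v => by
        rw [smul_eq_mul, Finset.mul_sum]
        refine Finset.sum_congr rfl fun i _ => ?_
        simp only [inner_smul_right, mul_left_comm _ c, integral_const_mul]
        ring)
  have hBsymm : ∀ ω u v, B ω u v = B ω v u := fun ω u v => by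
    simp only [B, LinearMap.mk₂_apply, mul_comm]
  have hBself : ∀ ω u, B ω u u =
      ∑ i, (inner ℝ (w i ω) u ^ 2 - ∫ ω', inner ℝ (w i ω') u ^ 2 ∂P) := fun ω u => by
    simp only [B, LinearMap.mk₂_apply, sq]
  set good := {ω | ∀ u, ‖u‖ = 1 →
      |∑ i, (inner ℝ (w i ω) u ^ 2 - ∫ ω', inner ℝ (w i ω') u ^ 2 ∂P)| ≤
        n * (576 * K ^ 2 * √((m : ℝ) / n))}
  have hbad : goodᶜ ⊆ ⋃ v ∈ N, {ω | t ≤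
      |∑ i, (inner ℝ (w i ω) v ^ 2 - ∫ ω', inner ℝ (w i ω') v ^ 2 ∂P)|} := by
    intro ω hω
    by_contra hcon
    simp only [Set.mem_iUnion, Set.mem_ofPred_eq, not_exists, not_le] at hcon
    refine hω fun u hu => ?_
    have h := abs_quadraticForm_le_of_net (B ω) (hBsymm ω) hN1 hnet (t := t)
      (fun v hv => by rw [hBself]; exact (hcon v hv).le) hu
    rw [hBself] at h
    refine h.trans_eq ?_
    rw [ht]; ring
  have hexp : (9 : ℝ) ≤ exp 3 := by
    have h1 := exp_one_gt_d9
    have h2 : exp 3 = exp 1 ^ 3 := by rw [← exp_nat_mul]; norm_num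
    rw [h2]
    calc (9 : ℝ) ≤ 2.7 ^ 3 := by norm_num
      _ ≤ exp 1 ^ 3 := by gcongr; linarith
  have hPbad : P.real goodᶜ ≤ 2 * exp (-m) := by
    calc P.real goodᶜ ≤ P.real (⋃ v ∈ N, {ω | t ≤
          |∑ i, (inner ℝ (w i ω) v ^ 2 - ∫ ω', inner ℝ (w i ω') v ^ 2 ∂P)|}) :=
        measureReal_mono hbad (measure_ne_top _ _)
      _ ≤ ∑ v ∈ N, P.real {ω | t ≤
          |∑ i, (inner ℝ (w i ω) v ^ 2 - ∫ ω', inner ℝ (w i ω') v ^ 2 ∂P)|} :=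
        measureReal_biUnion_finset_le _ _
      _ ≤ ∑ v ∈ N, 2 * exp (-4 * m) := by
        refine Finset.sum_le_sum fun v hv => ?_
        exact measureReal_abs_sum_centered_sq_ge_le hm hmn (fun i => hwm i v)
          (hind.comp (fun _ x => inner ℝ x v) fun _ => by fun_prop) hK0
          fun i => hK i v (hN1 v hv)
      _ = N.card * (2 * exp (-4 * m)) := by rw [Finset.sum_const, nsmul_eq_mul]
      _ ≤ exp (3 * m) * (2 * exp (-4 * m)) := by
        gcongr
        refine hcard.trans ?_
        rw [finrank_euclideanSpace_fin, mul_comm, exp_nat_mul]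
        gcongr
        norm_num
        exact hexp
      _ = 2 * exp (-m) := by
        rw [mul_left_comm, ← exp_add]
        ring_nf
  -- The good event need not be measurable; subadditivity of the outer measure suffices.
  have hone : (1 : ℝ) ≤ P.real good + P.real goodᶜ := by
    rw [← probReal_univ (μ := P), ← Set.union_compl_self good]
    exact measureReal_union_le _ _
  linarith

end Uniform

/-! ### Gaussian vectors and the constant `κ₀` -/

section Gaussian

variable {Ω : Type*} [MeasurableSpace Ω] {P : Measure Ω}

theorem psi2Norm_add_le {f g : Ω → ℝ} (hf : AEMeasurable f P) (hg : AEMeasurable g P) :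
    psi2Norm (fun ω => f ω + g ω) P ≤ psi2Norm f P + psi2Norm g P := by
  refine psi2Norm_le_iff.2 fun q hq => ?_
  rw [add_mul]
  refine (eLpNorm_add_le hf.aestronglyMeasurable hg.aestronglyMeasurable (by simpa using hq)).trans
    (add_le_add ?_ ?_)
  · exact psi2Norm_le_iff.1 le_rfl q hq
  · exact psi2Norm_le_iff.1 le_rfl q hq

theorem psi2Norm_const_mul_le (c : ℝ) (f : Ω → ℝ) :
    psi2Norm (fun ω => c * f ω) P ≤ ENNReal.ofReal |c| * psi2Norm f P := by
  refine psi2Norm_le_iff.2 fun q hq => ?_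
  have h : eLpNorm (fun ω => c * f ω) (ENNReal.ofReal q) P =
      ENNReal.ofReal |c| * eLpNorm f (ENNReal.ofReal q) P := by
    rw [← Real.enorm_eq_ofReal_abs]
    exact eLpNorm_const_smul c f _ P
  rw [h, mul_assoc]
  gcongr
  exact psi2Norm_le_iff.1 le_rfl q hq

theorem ProbabilityTheory.HasLaw.psi2Norm_eq {x : Ω → ℝ} {μ : Measure ℝ} (hx : HasLaw x μ P) :
    psi2Norm x P = psi2Norm id μ := by
  simp only [psi2Norm, ← hx.map_eq]
  congr! 4 with q hq
  rw [eLpNorm_map_measure (by fun_prop) hx.aemeasurable]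
  rfl

theorem hasLaw_inner_multivariateGaussian {m : ℕ} {S : Matrix (Fin m) (Fin m) ℝ} (hS : S.PosSemidef)
    {η : Ω → EuclideanSpace ℝ (Fin m)} (hη : HasLaw η (multivariateGaussian 0 S) P)
    (v : EuclideanSpace ℝ (Fin m)) :
    HasLaw (fun ω => inner ℝ v (η ω)) (gaussianReal 0 (v.ofLp ⬝ᵥ S *ᵥ v.ofLp).toNNReal) P := by
  refine HasLaw.fun_comp (Y := fun x => inner ℝ v x) ⟨by fun_prop, ?_⟩ hη
  have h := IsGaussian.map_eq_gaussianReal (μ := multivariateGaussian 0 S) (innerSL ℝ v)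
  rw [ContinuousLinearMap.integral_comp_id_comm IsGaussian.integrable_id,
    integral_id_multivariateGaussian, map_zero] at h
  have h2 : Var[innerSL ℝ v; multivariateGaussian 0 S] = v.ofLp ⬝ᵥ S *ᵥ v.ofLp := by
    rw [← covarianceBilin_multivariateGaussian (μ := 0) hS, covarianceBilin_self]
    · rfl
    · exact IsGaussian.memLp_two_id
  rw [h2] at h
  exact h

/-- With `r = √q`, the bound `|x| ≤ r exp (|x| / r)` gives `E |x| ^ q ≤ 2 r ^ q exp (q / 2)`, so the
`ψ₂`-norm is at most `4`. -/
theorem psi2Norm_gaussianReal_lt_top : psi2Norm id (gaussianReal 0 1) < ∞ := by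
  refine lt_of_le_of_lt (b := 4) ?_ ENNReal.ofNat_lt_top
  refine psi2Norm_le_iff.2 fun q hq => ?_
  have hq0 : 0 < q := by linarith
  set r := √q with hr
  have hr0 : 0 < r := Real.sqrt_pos.2 hq0
  have hrq : r ^ 2 = q := Real.sq_sqrt hq0.le
  rw [eLpNorm_eq_lintegral_rpow_enorm_toReal (ENNReal.ofReal_pos.2 hq0).ne' ENNReal.ofReal_ne_top,
    ENNReal.toReal_ofReal hq0.le, one_div, ENNReal.rpow_inv_le_iff hq0, ← ENNReal.ofReal_ofNat,
    ← ENNReal.ofReal_mul (by norm_num), ENNReal.ofReal_rpow_of_pos (by positivity)]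
  have hpt : ∀ x : ℝ, ‖id x‖ₑ ^ q ≤
      ENNReal.ofReal (r ^ q * (Real.exp (r * x) + Real.exp (-r * x))) := fun x => by
    rw [id, Real.enorm_eq_ofReal_abs, ENNReal.ofReal_rpow_of_nonneg (abs_nonneg _) hq0.le]
    refine ENNReal.ofReal_le_ofReal ?_
    have h1 : |x| / r ≤ Real.exp (|x| / r) := by linarith [Real.add_one_le_exp (|x| / r)]
    have h2 : |x| ≤ r * Real.exp (|x| / r) := by
      rw [div_le_iff₀ hr0] at h1; linarith
    calc |x| ^ q ≤ (r * Real.exp (|x| / r)) ^ q := by gcongr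
      _ = r ^ q * Real.exp (r * |x|) := by
        rw [Real.mul_rpow hr0.le (Real.exp_pos _).le, ← Real.exp_mul]
        congr 2
        rw [← hrq]; field_simp
      _ ≤ _ := by
        gcongr
        rcases abs_cases x with ⟨h, -⟩ | ⟨h, -⟩ <;> rw [h]
        · linarith [Real.exp_pos (-r * x)]
        · rw [mul_neg, ← neg_mul]; linarith [Real.exp_pos (r * x)]
  have hi := fun t : ℝ => integrable_exp_mul_gaussianReal (μ := 0) (v := 1) t
  have hmgf : ∀ t : ℝ, ∫ x, Real.exp (t * x) ∂gaussianReal 0 1 = Real.exp (t ^ 2 / 2) := fun t => by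
    have := mgf_gaussianReal (p := gaussianReal 0 1) (X := id) (μ := 0) (v := 1) (by simp) t
    simpa [mgf] using this
  calc ∫⁻ x, ‖id x‖ₑ ^ q ∂gaussianReal 0 1
      ≤ ∫⁻ x, ENNReal.ofReal (r ^ q * (Real.exp (r * x) + Real.exp (-r * x))) ∂gaussianReal 0 1 :=
        lintegral_mono hpt
    _ = ENNReal.ofReal (r ^ q * (2 * Real.exp (q / 2))) := by
        rw [← ofReal_integral_eq_lintegral_ofReal
          (f := fun x => r ^ q * (Real.exp (r * x) + Real.exp (-r * x)))
          (((hi r).add (hi (-r))).const_mul _)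
          (ae_of_all _ fun x => by positivity), integral_const_mul, integral_add (hi r) (hi (-r)),
          hmgf, hmgf, neg_sq, hrq, two_mul]
    _ ≤ ENNReal.ofReal ((4 * r) ^ q) := by
        refine ENNReal.ofReal_le_ofReal ?_
        rw [Real.mul_rpow (by norm_num) hr0.le, mul_comm]
        gcongr
        have h2 : (2 : ℝ) ≤ 2 ^ q := by
          simpa using Real.rpow_le_rpow_of_exponent_le (one_le_two : (1 : ℝ) ≤ 2) hq
        have h3 : Real.exp (q / 2) ≤ 2 ^ q := by
          rw [Real.rpow_def_of_pos two_pos]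
          gcongr
          nlinarith [Real.log_two_gt_d9]
        calc 2 * Real.exp (q / 2) ≤ 2 ^ q * 2 ^ q := by gcongr
          _ = 4 ^ q := by rw [← Real.mul_rpow two_pos.le two_pos.le]; norm_num

/-- `κ₀` is a genuine norm and not the junk value `0` of `ENNReal.toReal` at `∞`: every marginal of
the standard Gaussian vector is standard Gaussian, and its `ψ₂`-norm is finite. -/
theorem ofReal_kappa0 {d : ℕ} (hd : 0 < d) :
    ENNReal.ofReal (kappa0 d) = psi2Norm id (gaussianReal 0 1) := by
  have h : ∀ u ∈ Metric.sphere (0 : EuclideanSpace ℝ (Fin d)) 1,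
      psi2Norm (fun x => inner ℝ x u) (stdGaussian (EuclideanSpace ℝ (Fin d))) =
        psi2Norm id (gaussianReal 0 1) := by
    intro u hu
    have h1 := hasLaw_inner_multivariateGaussian (P := stdGaussian (EuclideanSpace ℝ (Fin d)))
      (η := id) Matrix.PosSemidef.one
      (by rw [multivariateGaussian_zero_one]; exact HasLaw.id) u
    rw [one_mulVec, EuclideanSpace.dotProduct_self_eq, mem_sphere_zero_iff_norm.1 hu, one_pow,
      Real.toNNReal_one] at h1
    rw [← h1.psi2Norm_eq]
    simp only [id, real_inner_comm]
  have hne : (Metric.sphere (0 : EuclideanSpace ℝ (Fin d)) 1).Nonempty :=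
    ⟨EuclideanSpace.single ⟨0, hd⟩ 1, by simp⟩
  rw [kappa0, psi2NormVec, biSup_congr h, biSup_const hne,
    ENNReal.ofReal_toReal psi2Norm_gaussianReal_lt_top.ne]

theorem half_le_kappa0_sq {d : ℕ} (hd : 0 < d) : 1 / 2 ≤ kappa0 d ^ 2 := by
  have h : eLpNorm id 2 (gaussianReal 0 1) = 1 := by
    have hm : MemLp id 2 (gaussianReal 0 1) := by simpa using memLp_id_gaussianReal 2
    have hv : ∫ x, id x ^ 2 ∂gaussianReal 0 1 = 1 := by
      rw [← variance_of_integral_eq_zero aemeasurable_id (by simp), variance_id_gaussianReal]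
      rfl
    rw [hm.eLpNorm_eq_integral_rpow_norm two_ne_zero ENNReal.ofNat_ne_top]
    simp [id] at hv
    simp [hv]
  have h2 := psi2Norm_le_iff.1 (ofReal_kappa0 hd).ge 2 (by norm_num)
  have hk : 0 ≤ kappa0 d := ENNReal.toReal_nonneg
  rw [ENNReal.ofReal_ofNat, h, ← ENNReal.ofReal_mul hk, ENNReal.one_le_ofReal] at h2
  have h3 : (1 : ℝ) ≤ (kappa0 d * √2) ^ 2 := by nlinarith
  rw [mul_pow, Real.sq_sqrt two_pos.le] at h3
  linarith

end Gaussian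

/-! ### Sub-Gaussian random matrices -/

section SubGaussianMatrix

variable {Ω : Type*} [MeasurableSpace Ω] {P : Measure Ω} {m p : ℕ}
  {X : Ω → Matrix (Fin m) (Fin p) ℝ} {κ : ℝ≥0} {muMin muMax : ℝ}

theorem gammaMat_isHermitian (X : Ω → Matrix (Fin m) (Fin p) ℝ) (P : Measure Ω)
    (u : EuclideanSpace ℝ (Fin m)) : (gammaMat X P u).IsHermitian := by
  ext a b
  simp only [gammaMat, conjTranspose_apply, of_apply, star_trivial, mul_comm]

theorem measurable_mulVec_dotProduct (hX : Measurable X) (r : Fin m → ℝ) (v : Fin p → ℝ) :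
    Measurable fun ω => v ⬝ᵥ ((X ω)ᵀ *ᵥ r) := by
  have h : ∀ a b, Measurable fun ω => X ω a b := fun a b =>
    (measurable_pi_apply b).comp ((measurable_pi_apply a).comp hX)
  simp only [dotProduct, mulVec, transpose_apply]
  fun_prop

namespace IsSubGaussianMatrix

variable (hX : IsSubGaussianMatrix X P κ muMin muMax)
include hX

theorem gammaMat_posDef {u : EuclideanSpace ℝ (Fin m)} (hu : ‖u‖ = 1) :
    (gammaMat X P u).PosDef :=
  posDef_of_lambdaMin_pos (gammaMat_isHermitian X P u)
    (hX.muMin_pos.trans_le (hX.muMin_le u (by simpa using hu)))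

/-- Write `⟨v, y⟩ = ⟨Γ^{1/2} v, Γ^{-1/2} y⟩` and normalise `Γ^{1/2} v`. -/
theorem psi2Norm_dotProduct_le_sqrt {u : EuclideanSpace ℝ (Fin m)} (hu : ‖u‖ = 1)
    (v : EuclideanSpace ℝ (Fin p)) :
    psi2Norm (fun ω => v.ofLp ⬝ᵥ ((X ω)ᵀ *ᵥ u.ofLp)) P ≤
      ENNReal.ofReal (κ * √(v.ofLp ⬝ᵥ gammaMat X P u *ᵥ v.ofLp)) := by
  have hG := hX.gammaMat_posDef hu
  set G := gammaMat X P u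
  set z : EuclideanSpace ℝ (Fin p) := WithLp.toLp 2 (CFC.sqrt G *ᵥ v.ofLp) with hz
  have hzn : √(v.ofLp ⬝ᵥ G *ᵥ v.ofLp) = ‖z‖ := by
    rw [← hG.dotProduct_sqrt_mulVec_self, ← Real.sqrt_sq (norm_nonneg z),
      ← EuclideanSpace.dotProduct_self_eq]
  rw [hzn]
  have hval : ∀ y, v.ofLp ⬝ᵥ y = z.ofLp ⬝ᵥ (invSqrt G *ᵥ y) := fun y => by
    rw [hz, ← (cfcSqrt_isHermitian G).dotProduct_mulVec_comm, mulVec_mulVec, hG.sqrt_mul_invSqrt,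
      one_mulVec]
  simp_rw [hval]
  rcases eq_or_ne z 0 with h0 | h0
  · have : psi2Norm (fun ω => z.ofLp ⬝ᵥ (invSqrt G *ᵥ ((X ω)ᵀ *ᵥ u.ofLp))) P ≤ 0 := by
      rw [h0]
      exact psi2Norm_le_iff.2 fun q _ => by simp
    exact this.trans zero_le
  have hz0 := norm_ne_zero_iff.2 h0
  have hsup : psi2Norm (fun ω => (‖z‖⁻¹ • z).ofLp ⬝ᵥ (invSqrt G *ᵥ ((X ω)ᵀ *ᵥ u.ofLp))) P ≤ κ := by
    refine le_trans ?_ hX.psi2Norm_le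
    exact le_iSup₂_of_le (‖z‖⁻¹ • z) (by simpa using norm_smul_inv_norm (𝕜 := ℝ) h0)
      (le_iSup₂_of_le (f := fun u _ => psi2Norm (fun ω => (‖z‖⁻¹ • z).ofLp ⬝ᵥ
        (invSqrt (gammaMat X P u) *ᵥ ((X ω)ᵀ *ᵥ u.ofLp))) P) u (by simpa using hu) le_rfl)
  have hfun : (fun ω => z.ofLp ⬝ᵥ (invSqrt G *ᵥ ((X ω)ᵀ *ᵥ u.ofLp))) = fun ω =>
      ‖z‖ * ((‖z‖⁻¹ • z).ofLp ⬝ᵥ (invSqrt G *ᵥ ((X ω)ᵀ *ᵥ u.ofLp))) := by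
    funext ω
    rw [WithLp.ofLp_smul, smul_dotProduct, smul_eq_mul, mul_inv_cancel_left₀ hz0]
  rw [hfun]
  refine (psi2Norm_const_mul_le _ _).trans ?_
  rw [abs_norm, mul_comm (κ : ℝ), ENNReal.ofReal_mul (norm_nonneg _), ENNReal.ofReal_coe_nnreal]
  gcongr

/-- The integrals defining `Γ_u` converge, because the `ψ₂`-norm bound puts the entries of `Xᵀ u` in
`L²`; so `Γ_u` is the second moment matrix of `Xᵀ u`. -/
theorem integral_dotProduct_sq_of_norm_eq_one {u : EuclideanSpace ℝ (Fin m)} (hu : ‖u‖ = 1)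
    (v : EuclideanSpace ℝ (Fin p)) :
    ∫ ω, (v.ofLp ⬝ᵥ ((X ω)ᵀ *ᵥ u.ofLp)) ^ 2 ∂P = v.ofLp ⬝ᵥ gammaMat X P u *ᵥ v.ofLp := by
  have hL : ∀ a, MemLp (fun ω => ((X ω)ᵀ *ᵥ u.ofLp) a) 2 P := fun a => by
    have h := memLp_two_of_psi2Norm_le
      (measurable_mulVec_dotProduct hX.measurable u.ofLp _).aemeasurable
      (hX.psi2Norm_dotProduct_le_sqrt hu (EuclideanSpace.single a 1))
    simpa using h
  have hint : ∀ a b, Integrable (fun ω => ((X ω)ᵀ *ᵥ u.ofLp) a * ((X ω)ᵀ *ᵥ u.ofLp) b) P :=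
    fun a b => (hL a).integrable_mul (hL b)
  have hexpand : ∀ ω, (v.ofLp ⬝ᵥ ((X ω)ᵀ *ᵥ u.ofLp)) ^ 2 =
      ∑ a, ∑ b, v a * v b * (((X ω)ᵀ *ᵥ u.ofLp) a * ((X ω)ᵀ *ᵥ u.ofLp) b) := fun ω => by
    rw [sq, dotProduct, Finset.sum_mul_sum]
    refine Finset.sum_congr rfl fun a _ => Finset.sum_congr rfl fun b _ => ?_
    ring
  have hG : v.ofLp ⬝ᵥ gammaMat X P u *ᵥ v.ofLp = ∑ a, ∑ b, v a * v b * gammaMat X P u a b := by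
    simp only [dotProduct, mulVec, Finset.mul_sum]
    refine Finset.sum_congr rfl fun a _ => Finset.sum_congr rfl fun b _ => ?_
    ring
  simp_rw [hexpand, hG]
  rw [integral_finsetSum _ fun a _ => integrable_finsetSum _ fun b _ => (hint a b).const_mul _]
  refine Finset.sum_congr rfl fun a _ => ?_
  rw [integral_finsetSum _ fun b _ => (hint a b).const_mul _]
  refine Finset.sum_congr rfl fun b _ => ?_
  rw [integral_const_mul, gammaMat, of_apply]

/-- First and second order control of the bilinear form `⟨v, Xᵀ r⟩`, for an arbitrary `r`, by
normalising `r`. -/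
theorem psi2Norm_dotProduct_le_and_integral_sq_bounds (r : EuclideanSpace ℝ (Fin m))
    (v : EuclideanSpace ℝ (Fin p)) (hr : r ≠ 0) :
    psi2Norm (fun ω => v.ofLp ⬝ᵥ ((X ω)ᵀ *ᵥ r.ofLp)) P ≤
        ENNReal.ofReal (κ * √(muMax * ‖v‖ ^ 2 * ‖r‖ ^ 2)) ∧
      muMin * ‖v‖ ^ 2 * ‖r‖ ^ 2 ≤ ∫ ω, (v.ofLp ⬝ᵥ ((X ω)ᵀ *ᵥ r.ofLp)) ^ 2 ∂P ∧
      ∫ ω, (v.ofLp ⬝ᵥ ((X ω)ᵀ *ᵥ r.ofLp)) ^ 2 ∂P ≤ muMax * ‖v‖ ^ 2 * ‖r‖ ^ 2 := by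
  set u := ‖r‖⁻¹ • r with hu
  have hu1 : ‖u‖ = 1 := norm_smul_inv_norm (𝕜 := ℝ) hr
  have hfun : ∀ ω, v.ofLp ⬝ᵥ ((X ω)ᵀ *ᵥ r.ofLp) = ‖r‖ * (v.ofLp ⬝ᵥ ((X ω)ᵀ *ᵥ u.ofLp)) :=
    fun ω => by
      rw [hu, WithLp.ofLp_smul, mulVec_smul, dotProduct_smul, smul_eq_mul,
        mul_inv_cancel_left₀ (norm_ne_zero_iff.2 hr)]
  have hmem : u ∈ Metric.sphere (0 : EuclideanSpace ℝ (Fin m)) 1 := by simpa using hu1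
  have hlow := lambdaMin_mul_le_dotProduct_mulVec (gammaMat_isHermitian X P u) v.ofLp
  have hup := dotProduct_mulVec_le_lambdaMax (gammaMat_isHermitian X P u) v.ofLp
  rw [EuclideanSpace.dotProduct_self_eq] at hlow hup
  have hlow' : muMin * ‖v‖ ^ 2 ≤ v.ofLp ⬝ᵥ gammaMat X P u *ᵥ v.ofLp :=
    le_trans (by gcongr; exact hX.muMin_le u hmem) hlow
  have hup' : v.ofLp ⬝ᵥ gammaMat X P u *ᵥ v.ofLp ≤ muMax * ‖v‖ ^ 2 :=
    hup.trans (by gcongr; exact hX.le_muMax u hmem)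
  simp_rw [hfun, mul_pow]
  rw [integral_const_mul, hX.integral_dotProduct_sq_of_norm_eq_one hu1]
  refine ⟨?_, ?_, ?_⟩
  · refine (psi2Norm_const_mul_le _ _).trans ?_
    refine (mul_le_mul_right (hX.psi2Norm_dotProduct_le_sqrt hu1 v) _).trans ?_
    rw [abs_norm, ← ENNReal.ofReal_mul (norm_nonneg _), Real.sqrt_mul' _ (sq_nonneg _),
      Real.sqrt_sq (norm_nonneg _), mul_comm, mul_assoc]
    gcongr
  · rw [mul_comm (‖r‖ ^ 2)]
    gcongr
  · rw [mul_comm (‖r‖ ^ 2)]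
    gcongr

end IsSubGaussianMatrix

end SubGaussianMatrix

/-! ### Whitened residuals -/

section Whitened

variable {Ω : Type*} [MeasurableSpace Ω] {P : Measure Ω} {m p : ℕ}
  {X : Ω → Matrix (Fin m) (Fin p) ℝ} {κ : ℝ≥0} {muMin muMax : ℝ}

/-- The residual `X D + e` of a pair `a = (X, e)` of design and noise, multiplied by `S^{-1/2}`. -/
noncomputable def whitenedResidual (S : Matrix (Fin m) (Fin m) ℝ) (D : EuclideanSpace ℝ (Fin p))
    (a : Matrix (Fin m) (Fin p) ℝ × EuclideanSpace ℝ (Fin m)) : EuclideanSpace ℝ (Fin m) :=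
  WithLp.toLp 2 (invSqrt S *ᵥ (a.1 *ᵥ D.ofLp + a.2.ofLp))

theorem measurable_whitenedResidual (S : Matrix (Fin m) (Fin m) ℝ) (D : EuclideanSpace ℝ (Fin p)) :
    Measurable (whitenedResidual S D) := by
  have h : ∀ a b, Measurable fun x : Matrix (Fin m) (Fin p) ℝ × EuclideanSpace ℝ (Fin m) =>
      x.1 a b := fun a b =>
    (measurable_pi_apply b).comp ((measurable_pi_apply a).comp measurable_fst)
  refine (WithLp.measurable_toLp 2 _).comp (measurable_pi_lambda _ fun i => ?_)
  simp only [dotProduct, mulVec, Pi.add_apply]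
  fun_prop

theorem inner_whitenedResidual (S : Matrix (Fin m) (Fin m) ℝ) (D : EuclideanSpace ℝ (Fin p))
    (a : Matrix (Fin m) (Fin p) ℝ × EuclideanSpace ℝ (Fin m)) (u : EuclideanSpace ℝ (Fin m)) :
    inner ℝ (whitenedResidual S D a) u =
      D.ofLp ⬝ᵥ (a.1ᵀ *ᵥ (invSqrt S *ᵥ u.ofLp)) +
        inner ℝ (WithLp.toLp 2 (invSqrt S *ᵥ u.ofLp)) a.2 := by
  rw [EuclideanSpace.inner_eq_star_dotProduct, EuclideanSpace.inner_eq_star_dotProduct]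
  simp only [whitenedResidual, star_trivial]
  rw [(invSqrt_isHermitian S).dotProduct_mulVec_comm, dotProduct_add, dotProduct_mulVec,
    ← mulVec_transpose, dotProduct_comm D.ofLp, dotProduct_comm a.2.ofLp]

/-- In each direction, the whitened residual is sub-Gaussian and its second moment exceeds `1` by an
amount comparable to `‖D‖²`: the noise contributes exactly `1` and is uncorrelated with the
design. -/
theorem whitenedResidual_bounds [IsProbabilityMeasure P] (hm : 0 < m)
    (hX : IsSubGaussianMatrix X P κ muMin muMax) (hmax : 0 ≤ muMax)
    {S : Matrix (Fin m) (Fin m) ℝ} (hS : S.PosDef)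
    {η : Ω → EuclideanSpace ℝ (Fin m)} (hη : HasLaw η (multivariateGaussian 0 S) P)
    (hind : IndepFun X η P) (D : EuclideanSpace ℝ (Fin p))
    {u : EuclideanSpace ℝ (Fin m)} (hu : ‖u‖ = 1) :
    psi2Norm (fun ω => inner ℝ (whitenedResidual S D (X ω, η ω)) u) P ≤
        ENNReal.ofReal (kappa0 m + κ * √(muMax / lambdaMin S) * ‖D‖) ∧
      1 + muMin / lambdaMax S * ‖D‖ ^ 2 ≤
        ∫ ω, inner ℝ (whitenedResidual S D (X ω, η ω)) u ^ 2 ∂P ∧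
      ∫ ω, inner ℝ (whitenedResidual S D (X ω, η ω)) u ^ 2 ∂P ≤
        1 + muMax / lambdaMin S * ‖D‖ ^ 2 := by
  set r : EuclideanSpace ℝ (Fin m) := WithLp.toLp 2 (invSqrt S *ᵥ u.ofLp) with hr
  have hrS : r.ofLp ⬝ᵥ S *ᵥ r.ofLp = 1 := by
    rw [hr, hS.invSqrt_mulVec_dotProduct_mulVec, EuclideanSpace.dotProduct_self_eq, hu, one_pow]
  have hr0 : r ≠ 0 := by
    intro h
    simp [h] at hrS
  have hrpos : 0 < ‖r‖ ^ 2 := by positivity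
  have hlmin := hS.lambdaMin_pos hm
  have hr1 : ‖r‖ ^ 2 ≤ 1 / lambdaMin S := by
    have := lambdaMin_mul_le_dotProduct_mulVec hS.1 r.ofLp
    rw [hrS, EuclideanSpace.dotProduct_self_eq] at this
    rw [le_div_iff₀ hlmin]; linarith
  have hr2' : 1 ≤ lambdaMax S * ‖r‖ ^ 2 := by
    have := dotProduct_mulVec_le_lambdaMax hS.1 r.ofLp
    rwa [hrS, EuclideanSpace.dotProduct_self_eq] at this
  have hlmax : 0 < lambdaMax S := pos_of_mul_pos_left (one_pos.trans_le hr2') hrpos.le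
  have hr2 : 1 / lambdaMax S ≤ ‖r‖ ^ 2 := by
    rw [div_le_iff₀ hlmax]; linarith
  set x : Ω → ℝ := fun ω => D.ofLp ⬝ᵥ ((X ω)ᵀ *ᵥ r.ofLp) with hx
  set g : Ω → ℝ := fun ω => inner ℝ r (η ω) with hg
  have hsum : ∀ ω, inner ℝ (whitenedResidual S D (X ω, η ω)) u = x ω + g ω := fun ω =>
    inner_whitenedResidual S D (X ω, η ω) u
  obtain ⟨hx1, hx2, hx3⟩ := hX.psi2Norm_dotProduct_le_and_integral_sq_bounds r D hr0
  have hxm : Measurable x := measurable_mulVec_dotProduct hX.measurable _ _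
  have hxL : MemLp x 2 P := memLp_two_of_psi2Norm_le hxm.aemeasurable hx1
  have hglaw : HasLaw g (gaussianReal 0 1) P := by
    have h := hasLaw_inner_multivariateGaussian hS.posSemidef hη r
    rwa [hrS, Real.toNNReal_one] at h
  have hgpsi : psi2Norm g P = ENNReal.ofReal (kappa0 m) := by
    rw [hglaw.psi2Norm_eq, ofReal_kappa0 hm]
  have hgL : MemLp g 2 P := memLp_two_of_psi2Norm_le hglaw.aemeasurable hgpsi.le
  have hg0 : ∫ ω, g ω ∂P = 0 := by rw [hglaw.integral_eq]; simp
  have hg2 : ∫ ω, g ω ^ 2 ∂P = 1 := by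
    rw [← variance_of_integral_eq_zero hglaw.aemeasurable hg0, hglaw.variance_eq,
      variance_id_gaussianReal]
    rfl
  have hxg : IndepFun x g P :=
    hind.comp (φ := fun A => D.ofLp ⬝ᵥ (Aᵀ *ᵥ r.ofLp)) (ψ := fun e => inner ℝ r e)
      (measurable_mulVec_dotProduct measurable_id _ _) (by fun_prop)
  have hcross : ∫ ω, x ω * g ω ∂P = 0 := by
    rw [hxg.integral_fun_mul_eq_mul_integral hxL.1 hgL.1, hg0, mul_zero]
  have hsq : ∫ ω, (x ω + g ω) ^ 2 ∂P = 1 + ∫ ω, x ω ^ 2 ∂P := by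
    have hexp : ∀ ω, (x ω + g ω) ^ 2 = x ω ^ 2 + 2 * (x ω * g ω) + g ω ^ 2 := fun ω => by ring
    have hint : Integrable (fun ω => 2 * (x ω * g ω)) P := (hxL.integrable_mul hgL).const_mul 2
    simp_rw [hexp]
    rw [integral_add (f := fun ω => x ω ^ 2 + 2 * (x ω * g ω))
      (hxL.integrable_sq.add hint) hgL.integrable_sq,
      integral_add hxL.integrable_sq hint, integral_const_mul,
      hcross, hg2]
    ring
  simp_rw [hsum]
  rw [hsq]
  refine ⟨?_, ?_, ?_⟩
  · refine (psi2Norm_add_le hxm.aemeasurable hglaw.aemeasurable).trans ?_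
    have hk : 0 ≤ kappa0 m := ENNReal.toReal_nonneg
    rw [hgpsi, add_comm, ENNReal.ofReal_add hk (by positivity)]
    refine add_le_add le_rfl (hx1.trans (ENNReal.ofReal_le_ofReal ?_))
    rw [mul_assoc (κ : ℝ)]
    refine mul_le_mul_of_nonneg_left ?_ κ.coe_nonneg
    rw [← Real.sqrt_sq (norm_nonneg D), ← Real.sqrt_mul (by positivity),
      Real.sqrt_sq (norm_nonneg D)]
    refine Real.sqrt_le_sqrt ?_
    calc muMax * ‖D‖ ^ 2 * ‖r‖ ^ 2 ≤ muMax * ‖D‖ ^ 2 * (1 / lambdaMin S) := by gcongr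
      _ = _ := by ring
  · gcongr
    refine le_trans ?_ hx2
    have := hX.muMin_pos
    calc muMin / lambdaMax S * ‖D‖ ^ 2 = muMin * ‖D‖ ^ 2 * (1 / lambdaMax S) := by ring
      _ ≤ _ := by gcongr
  · gcongr
    refine hx3.trans ?_
    calc muMax * ‖D‖ ^ 2 * ‖r‖ ^ 2 ≤ muMax * ‖D‖ ^ 2 * (1 / lambdaMin S) := by gcongr
      _ = _ := by ring

theorem residualCov_isHermitian {n : ℕ} (X : Fin n → Matrix (Fin m) (Fin p) ℝ)
    (y : Fin n → EuclideanSpace ℝ (Fin m)) (θ : EuclideanSpace ℝ (Fin p)) :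
    (residualCov X y θ).IsHermitian := by
  ext a b
  simp [residualCov, Matrix.sum_apply, vecMulVec_apply, mul_comm]

theorem dotProduct_whitened_residualCov {n : ℕ} (S : Matrix (Fin m) (Fin m) ℝ)
    (X : Fin n → Matrix (Fin m) (Fin p) ℝ) (η : Fin n → EuclideanSpace ℝ (Fin m))
    (θs θ : EuclideanSpace ℝ (Fin p)) (u : EuclideanSpace ℝ (Fin m)) :
    u.ofLp ⬝ᵥ (invSqrt S *
        residualCov X (fun i => WithLp.toLp 2 (X i *ᵥ θs.ofLp) + η i) θ * invSqrt S) *ᵥ u.ofLp =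
      1 / (n : ℝ) * ∑ i, inner ℝ (whitenedResidual S (θs - θ) (X i, η i)) u ^ 2 := by
  rw [← mulVec_mulVec, ← mulVec_mulVec, (invSqrt_isHermitian S).dotProduct_mulVec_comm]
  simp only [residualCov, smul_mulVec, dotProduct_smul, smul_eq_mul, sum_mulVec, dotProduct_sum]
  congr 1
  refine Finset.sum_congr rfl fun i _ => ?_
  have hres : (WithLp.toLp 2 (X i *ᵥ θs.ofLp) + η i).ofLp - X i *ᵥ θ.ofLp =
      X i *ᵥ (θs - θ).ofLp + (η i).ofLp := by
    rw [WithLp.ofLp_sub, mulVec_sub, WithLp.ofLp_add]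
    abel
  rw [hres, vecMulVec_mulVec, EuclideanSpace.inner_eq_star_dotProduct]
  simp only [whitenedResidual, star_trivial, dotProduct_smul, op_smul_eq_smul]
  rw [(invSqrt_isHermitian S).dotProduct_mulVec_comm, smul_eq_mul, sq,
    dotProduct_comm (invSqrt S *ᵥ (X i *ᵥ (θs - θ).ofLp + (η i).ofLp)),
    ← (invSqrt_isHermitian S).dotProduct_mulVec_comm]

end Whitened

/-! ### Sample size and deviation -/

/-- The sample size condition turns the deviation `576 K² √(m / n)` of the empirical second moment,
with `K = k + κ √b`, into the Gaussian deviation plus the smallest possible excess `a` of the second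
moment over `1`. -/
theorem deviation_le {δ k κ a b R K : ℝ} (hδ : 0 ≤ δ) (ha : 0 ≤ a) (hR : 0 ≤ R)
    (hb : b = R * a) (hK : K = k + κ * √b) (hδR : 34 ^ 4 * δ ^ 2 * (κ ^ 4 * R ^ 2) ≤ 1) :
    576 * K ^ 2 * δ ≤ 34 ^ 2 * k ^ 2 * δ + a := by
  have hb0 : 0 ≤ b := hb ▸ mul_nonneg hR ha
  have h1 : 34 ^ 2 * κ ^ 2 * R * δ ≤ 1 := by
    refine (sq_le_one_iff₀ (by positivity)).1 ?_
    calc (34 ^ 2 * κ ^ 2 * R * δ) ^ 2 = 34 ^ 4 * δ ^ 2 * (κ ^ 4 * R ^ 2) := by ring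
      _ ≤ 1 := hδR
  have h2 : K ^ 2 ≤ 2 * k ^ 2 + 2 * (κ ^ 2 * b) := by
    have h3 := add_sq_le (a := k) (b := κ * √b)
    rw [mul_pow, Real.sq_sqrt hb0] at h3
    rw [hK]; linarith
  have h4 : 34 ^ 2 * (κ ^ 2 * b) * δ ≤ a := by
    calc 34 ^ 2 * (κ ^ 2 * b) * δ = 34 ^ 2 * κ ^ 2 * R * δ * a := by rw [hb]; ring
      _ ≤ 1 * a := by gcongr
      _ = a := one_mul a
  calc 576 * K ^ 2 * δ ≤ 576 * (2 * k ^ 2 + 2 * (κ ^ 2 * b)) * δ := by gcongr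
    _ ≤ 34 ^ 2 * k ^ 2 * δ + 34 ^ 2 * (κ ^ 2 * b) * δ := by
      nlinarith [mul_nonneg (sq_nonneg k) hδ, mul_nonneg (mul_nonneg (sq_nonneg κ) hb0) hδ]
    _ ≤ _ := by gcongr

theorem mainTheorem3 :
    ∃ C C₁ : ℝ, 0 < C ∧ 0 < C₁ ∧
      ∀ {Ω : Type*} [MeasurableSpace Ω] (P : Measure Ω) [IsProbabilityMeasure P]
        (n m p : ℕ) (_ : 0 < m) (_ : 0 < p)
        (S : Matrix (Fin m) (Fin m) ℝ) (_ : S.PosDef)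
        (θs θ : EuclideanSpace ℝ (Fin p))
        (κ : ℝ≥0) (muMin muMax : ℝ)
        (X : Fin n → Ω → Matrix (Fin m) (Fin p) ℝ)
        (η y : Fin n → Ω → EuclideanSpace ℝ (Fin m))
        (_ : ∀ i, IsSubGaussianMatrix (X i) P κ muMin muMax)
        (_ : ∀ i, HasLaw (η i) (multivariateGaussian 0 S) P)
        (_ : ∀ i, IndepFun (X i) (η i) P)
        (_ : iIndepFun (fun i ω => (X i ω, η i ω)) P)
        (_ : ∀ i ω, y i ω = WithLp.toLp 2 (X i ω *ᵥ θs.ofLp) + η i ω)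
        (_ : C ^ 4 * m * max
            (4 * (kappa0 m + κ * √(muMax / lambdaMin S) * ‖θs - θ‖) ^ 4)
            ((κ : ℝ) ^ 4 * ((lambdaMax S * muMax) / (lambdaMin S * muMin)) ^ 2) ≤ (n : ℝ)),
        1 - 2 * Real.exp (-C₁ * m) ≤
          P.real {ω |
            lambdaMax (invSqrt S * residualCov (fun i => X i ω) (fun i => y i ω) θ * invSqrt S)
                ≤ 1 + C ^ 2 * kappa0 m ^ 2 * √((m : ℝ) / n)
                  + 2 * muMax / lambdaMin S * ‖θs - θ‖ ^ 2 ∧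
            1 - C ^ 2 * kappa0 m ^ 2 * √((m : ℝ) / n) ≤
              lambdaMin
                (invSqrt S * residualCov (fun i => X i ω) (fun i => y i ω) θ * invSqrt S)} := by
  refine ⟨34, 1, by norm_num, one_pos, ?_⟩
  intro Ω _ P _ n m p hm hp S hS θs θ κ muMin muMax X η y hX hη hXη hind hy hn
  have hm' : (0 : ℝ) < m := by exact_mod_cast hm
  have hk0 : 0 ≤ kappa0 m := ENNReal.toReal_nonneg
  have hkhalf := half_le_kappa0_sq hm
  have hkpos : 0 < kappa0 m := by
    rcases hk0.eq_or_lt with h | h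
    · rw [← h] at hkhalf; norm_num at hkhalf
    · exact h
  set D := θs - θ with hD
  set K := kappa0 m + κ * √(muMax / lambdaMin S) * ‖D‖ with hK
  have hKk : kappa0 m ≤ K := le_add_of_nonneg_right (by positivity)
  have hK0 : 0 < K := hkpos.trans_le hKk
  have hn1 : (34 : ℝ) ^ 4 * m * (4 * K ^ 4) ≤ n :=
    le_trans (by gcongr; exact le_max_left _ _) hn
  have hn2 : (34 : ℝ) ^ 4 * m * ((κ : ℝ) ^ 4 *
      ((lambdaMax S * muMax) / (lambdaMin S * muMin)) ^ 2) ≤ n :=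
    le_trans (by gcongr; exact le_max_right _ _) hn
  -- Only `κ₀ ≥ 1 / √2` is needed of the Gaussian constant: it gives `4 K ^ 4 ≥ 1`, hence `m ≤ n`.
  have hmn : (m : ℝ) ≤ n := by
    refine le_trans ?_ hn1
    have h4 : 1 ≤ 4 * K ^ 4 := by
      have : 1 / 2 ≤ K ^ 2 := hkhalf.trans (by gcongr)
      nlinarith
    nlinarith
  have hmn' : m ≤ n := by exact_mod_cast hmn
  have hnpos : (0 : ℝ) < n := hm'.trans_le hmn
  -- The index set of the sample is now known to be nonempty, so the conditions on `X` have content.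
  have hXi := hX ⟨0, hm.trans_le hmn'⟩
  have hmin := hXi.muMin_pos
  have hlmin := hS.lambdaMin_pos hm
  have hlmax : 0 < lambdaMax S :=
    hlmin.trans_le (lambdaMin_le_lambdaMax hm hS.1)
  have hmax : 0 < muMax := by
    have hu : EuclideanSpace.single (⟨0, hm⟩ : Fin m) (1 : ℝ) ∈
      Metric.sphere (0 : EuclideanSpace ℝ (Fin m)) 1 := by simp
    refine hmin.trans_le ((hXi.muMin_le _ hu).trans (le_trans ?_ (hXi.le_muMax _ hu)))
    exact lambdaMin_le_lambdaMax hp (gammaMat_isHermitian _ _ _)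
  set δ := √((m : ℝ) / n) with hδ
  have hδ0 : 0 ≤ δ := Real.sqrt_nonneg _
  have hδsq : δ ^ 2 = m / n := Real.sq_sqrt (by positivity)
  set a := muMin / lambdaMax S * ‖D‖ ^ 2 with ha
  set b := muMax / lambdaMin S * ‖D‖ ^ 2 with hb
  have ha0 : 0 ≤ a := by positivity
  have hdev : 576 * K ^ 2 * δ ≤ 34 ^ 2 * kappa0 m ^ 2 * δ + a := by
    refine deviation_le (κ := κ) (b := b)
      (R := (lambdaMax S * muMax) / (lambdaMin S * muMin)) hδ0 ha0 (by positivity)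
      ?_ ?_ ?_
    · rw [ha, hb]
      field_simp
    · rw [hK, hb, Real.sqrt_mul' _ (sq_nonneg _), Real.sqrt_sq (norm_nonneg _), mul_assoc]
    · rw [hδsq]
      rw [← div_le_one hnpos] at hn2
      refine le_trans (le_of_eq ?_) hn2
      ring
  have hbounds := fun i (u : EuclideanSpace ℝ (Fin m)) (hu : ‖u‖ = 1) =>
    whitenedResidual_bounds hm (hX i) hmax.le hS (hη i) (hXη i) D hu
  have hmeas : ∀ i, AEMeasurable (fun ω => whitenedResidual S D (X i ω, η i ω)) P := fun i =>
    (measurable_whitenedResidual S D).comp_aemeasurable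
      ((hX i).measurable.aemeasurable.prodMk (hη i).aemeasurable)
  have hconc := one_sub_le_measureReal_forall_abs_sum_centered_sq_le hm hmn' hmeas
    (hind.comp (fun _ => whitenedResidual S D) fun _ => measurable_whitenedResidual S D) hK0
    fun i u hu => (hbounds i u hu).1
  rw [neg_one_mul]
  refine hconc.trans (measureReal_mono fun ω hω => ?_)
  have hy' : (fun i => y i ω) = fun i => WithLp.toLp 2 (X i ω *ᵥ θs.ofLp) + η i ω :=
    funext fun i => hy i ω
  -- In each direction, the quadratic form is within `34² κ₀² δ + a` of a number in
  -- `[1 + a, 1 + b]`.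
  have hquad : ∀ u : EuclideanSpace ℝ (Fin m), ‖u‖ = 1 →
      1 - 34 ^ 2 * kappa0 m ^ 2 * δ ≤ u.ofLp ⬝ᵥ (invSqrt S *
        residualCov (fun i => X i ω) (fun i => y i ω) θ * invSqrt S) *ᵥ u.ofLp ∧
      u.ofLp ⬝ᵥ (invSqrt S *
        residualCov (fun i => X i ω) (fun i => y i ω) θ * invSqrt S) *ᵥ u.ofLp ≤
        1 + 34 ^ 2 * kappa0 m ^ 2 * δ + (a + b) := by
    intro u hu
    rw [hy', dotProduct_whitened_residualCov, one_div_mul_eq_div, le_div_iff₀ hnpos,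
      div_le_iff₀ hnpos]
    have h1 := hω u hu
    rw [Finset.sum_sub_distrib, abs_le] at h1
    have hup := Finset.sum_le_sum fun i (_ : i ∈ Finset.univ) => (hbounds i u hu).2.2
    have hlow := Finset.sum_le_sum fun i (_ : i ∈ Finset.univ) => (hbounds i u hu).2.1
    rw [Finset.sum_const, Finset.card_univ, Fintype.card_fin, nsmul_eq_mul] at hup hlow
    have hdev' := mul_le_mul_of_nonneg_left hdev hnpos.le
    constructor <;> linarith
  have hab : a ≤ b := by
    obtain ⟨-, h1, h2⟩ := hbounds ⟨0, hm.trans_le hmn'⟩ (EuclideanSpace.single ⟨0, hm⟩ 1) (by simp)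
    linarith [h1.trans h2]
  have hherm : (invSqrt S * residualCov (fun i => X i ω) (fun i => y i ω) θ *
      invSqrt S).IsHermitian := by
    have h := isHermitian_mul_mul_conjTranspose (invSqrt S)
      (residualCov_isHermitian (fun i => X i ω) (fun i => y i ω) θ)
    rwa [(invSqrt_isHermitian S).eq] at h
  refine ⟨lambdaMax_le hm hherm fun u hu => (hquad u hu).2.trans ?_,
    le_lambdaMin hm hherm fun u hu => (hquad u hu).1⟩
  have h2b : 2 * muMax / lambdaMin S * ‖D‖ ^ 2 = b + b := by rw [hb]; ring
  linarith
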